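/- **Setting.** Arms $i\in[K]$ have unknown $1$-sub-Gaussian laws $\mathbb F_i$ on $S\subseteq\mathbb R$ (i.e. $\mathbb E\,e^{t(X-\mathbb EX)}\le e^{t^2/2}$ for all $t$); each selection of arm $i$ yields an independent reward of law $\mathbb F_i$. Let $h:[0,1]\to[0,1]$, $h(0)=0$, and $U_h(Q)=\int_{-\infty}^0(h(1-Q(x))-h(1))\,dx+\int_0^\infty h(1-Q(x))\,dx$ for a distribution function $Q$; put $V(\alpha)=U_h(\sum_i\alpha(i)\mathbb F_i)$ for $\alpha$ in the simplex $\Delta^{K-1}$. Let $\|\cdot\|_{\rm W}$ be the $1$-Wasserstein distance, $\|Q-R\|_{\rm W}=\int|Q-R|\,dx$, and let $\mathcal P(S)$ be the set of probability measures on $S$ with finite first moment. Assume that $U_h$ is Hölder continuous with exponent $q\in(0,1]$ and constant $\mathcal L>0$ at the mixtures of the arms: for every mixture $G$ of the $\mathbb F_i$ and every $G'\in\mathcal P(S)$, $U_h(G')$ is finite and $|U_h(G)-U_h(G')|\le\mathcal L\|G-G'\|_{\rm W}^q$. Let $B_h=\max_{\alpha\in\Delta^{K-1}}|V(\alpha)|$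 and $W=\sup_{\alpha\ne\beta\in\Delta^{K-1}}\|\sum_i(\alpha(i)-\beta(i))\mathbb F_i\|_{\rm W}/\|\alpha-\beta\|_1$. For $\varepsilon>0$ let $\Delta_\varepsilon^{K-1}$ be the set of $a\in\Delta^{K-1}$ with all $a(i)\ge\varepsilon/2$ and $a(i)\in\varepsilon(\mathbb N_0+\tfrac12)$ for $i<K$ (the last coordinate takes up the remaining weight); assume it has at least two elements. Let $\alpha^\star$ maximize $V$ over $\Delta^{K-1}$, $a^{(1)}$ maximize $V$ over $\Delta_\varepsilon^{K-1}$, $a^{(2)}$ maximize $V$ over $\Delta_\varepsilon^{K-1}\setminus\{a^{(1)}\}$, and let $\delta_{01}(\varepsilon)=V(\alpha^\star)-V(a^{(1)})$, $\delta_{12}(\varepsilon)=V(a^{(1)})-V(a^{(2)})$. For $\rho\in(0,1)$ let $T(\varepsilon)=\frac2\varepsilon(T_0(\varepsilon)-1)$, where $$T_0(\varepsilon)=\inf\Big\{t\ge1:\ \frac{2\sqrt{2e\log s}+32}{\sqrt{\rho s\varepsilon}}\le\frac1{16}\Big(\frac{\delta_{12}(\varepsilon)}{2K\mathcal L}\Big)^{1/q}\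 \ \forall s\ge t\Big\}\qquad(\inf\emptyset=\infty).$$ **Algorithms** (horizon $T$, exploration rate $\rho$). Let $\tau_t(i)$ be the number of selections of arm $i$ in the first $t$ rounds, $\mathbb F_{i,t}$ its empirical law, and $r_t(i)=16\,(\sqrt{2e\log T}+32)/\sqrt{\tau_t(i)}$. First sample each arm $N=\lceil\rho T\varepsilon/4\rceil$ times. For $t\ge KN$ compute $a_t\in\arg\max_{a\in\Delta_\varepsilon^{K-1}}{\rm UCB}_t(a)$, keeping $a_t=a_{t-1}$ whenever $a_{t-1}$ is still a maximizer, and select next an arm maximizing $t\,a_t(i)-\tau_t(i)$. Here for PM-UCB-M, ${\rm UCB}_t(a)=\sup\{U_h(\sum_ia(i)\eta_i):\eta_i\in\mathcal P(S),\ \|\mathbb F_{i,t}-\eta_i\|_{\rm W}\le r_t(i)\ \forall i\}$, and for CE-UCB-M, ${\rm UCB}_t(a)=U_h(\sum_ia(i)\mathbb F_{i,t})+\mathcal L\sum_i(a(i)\,r_t(i))^q$. Remaining ties are broken arbitrarily. The regret is $\mathfrak R(T)=V(\alpha^\star)-\mathbb E[V(\tau_T/T)]$. **Theorem.** For every such $\varepsilon$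 and every $T>\max\{e^K,T(\varepsilon)\}$, both PM-UCB-M and CE-UCB-M satisfy $$\mathfrak R(T)\le\big[B_h+2\mathcal LK(W^q+1)\big]\Big[\frac{64}{\sqrt{\varepsilon\rho T}}\big(\sqrt{2e\log T}+32\big)\Big]^q+\delta_{01}(\varepsilon).$$ -/

import Mathlib

namespace PMBandit

open MeasureTheory ProbabilityTheory

noncomputable section

/-! ## Preference metrics, the Wasserstein distance and mixtures of arms

Distribution functions are represented as functions `ℝ → ℝ`. -/

/-- The preference metric (signed Choquet integral) of a distribution function `Q` for the
distortion function `h`. -/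
def prefMetric (h Q : ℝ → ℝ) : ℝ :=
  (∫ x in Set.Iic (0 : ℝ), (h (1 - Q x) - h 1)) + ∫ x in Set.Ioi (0 : ℝ), h (1 - Q x)

/-- Both integrals in the preference metric of `Q` converge absolutely. -/
def PrefMetricFinite (h Q : ℝ → ℝ) : Prop :=
  IntegrableOn (fun x => h (1 - Q x) - h 1) (Set.Iic (0 : ℝ)) ∧
    IntegrableOn (fun x => h (1 - Q x)) (Set.Ioi (0 : ℝ))

/-- The `1`-Wasserstein distance of two laws on the line with finite first moment, in terms of
their distribution functions: `∫ |Q x - R x| dx`. -/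
def wass (Q R : ℝ → ℝ) : ℝ := ∫ x, |Q x - R x|

/-- `𝒫(S)`: the probability measures on `S ⊆ ℝ` with finite first moment. -/
structure FiniteMomentLaw (S : Set ℝ) (η : Measure ℝ) : Prop where
  prob : IsProbabilityMeasure η
  support : ∀ᵐ x ∂η, x ∈ S
  moment : Integrable (fun x : ℝ => x) η

/-- A `1`-sub-Gaussian law: `E[exp(t (X - E X))] ≤ exp(t² / 2)` for all real `t`. -/
def IsOneSubGaussian (η : Measure ℝ) : Prop :=
  HasSubgaussianMGF (fun x : ℝ => x - ∫ y, y ∂η) 1 η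

/-- The mixture `∑ i, α i * Q i` of distribution functions. -/
def mix {K : ℕ} (α : Fin K → ℝ) (Q : Fin K → ℝ → ℝ) : ℝ → ℝ := fun x => ∑ i, α i * Q i x

/-- The distribution functions of the arms. -/
def armCDF {K : ℕ} (ν : Fin K → Measure ℝ) : Fin K → ℝ → ℝ := fun i x => cdf (ν i) x

/-- `V(α, F)`: the preference metric of the mixture of the arms with coefficients `α`. -/
def V {K : ℕ} (h : ℝ → ℝ) (ν : Fin K → Measure ℝ) (α : Fin K → ℝ) : ℝ :=
  prefMetric h (mix α (armCDF ν))

/-- Hölder continuity of the preference metric, with exponent `q` and constant `L`, at the mixtures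
of the arms: for every mixture `F_α` of the arms and every `G ∈ 𝒫(S)`, the preference metric of `G`
is finite and `|U(F_α) - U(G)| ≤ L * W₁(F_α, G) ^ q`. -/
def IsHolderPM {K : ℕ} (h : ℝ → ℝ) (S : Set ℝ) (ν : Fin K → Measure ℝ) (q L : ℝ) : Prop :=
  ∀ α ∈ stdSimplex ℝ (Fin K), ∀ G : Measure ℝ, FiniteMomentLaw S G →
    PrefMetricFinite h (cdf G) ∧
      |V h ν α - prefMetric h (cdf G)| ≤ L * wass (mix α (armCDF ν)) (cdf G) ^ q

/-- `W`: the maximal ratio of the Wasserstein distance of two mixtures of the arms to the `ℓ₁`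
distance of their coefficients. -/
def wassRatio {K : ℕ} (ν : Fin K → Measure ℝ) : ℝ :=
  sSup {w : ℝ | ∃ α ∈ stdSimplex ℝ (Fin K), ∃ β ∈ stdSimplex ℝ (Fin K), α ≠ β ∧
    w = wass (mix α (armCDF ν)) (mix β (armCDF ν)) / ∑ i, |α i - β i|}

/-- `B_h`: the maximal (absolute) value of the preference metric over the mixtures of the arms. For
nonnegative rewards the preference metric is nonnegative, so this is just its maximum. -/
def maxPM {K : ℕ} (h : ℝ → ℝ) (ν : Fin K → Measure ℝ) : ℝ :=
  sSup {b : ℝ | ∃ α ∈ stdSimplex ℝ (Fin K), b = |V h ν α|}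

/-! ## Discretized mixing coefficients and the time threshold -/

/-- The discretized simplex. All coordinates are at least `ε / 2` and sum to `1`, and all but the
last one are midpoints `ε (n + 1/2)`; the last one makes up for the remaining weight (it is itself
such a midpoint exactly when `1/ε - K/2` is an integer). -/
def grid (K : ℕ) (ε : ℝ) : Set (Fin K → ℝ) :=
  {a | (∀ i, ε / 2 ≤ a i) ∧ ∑ i, a i = 1 ∧
    ∀ i : Fin K, (i : ℕ) + 1 < K → ∃ n : ℕ, a i = ε * ((n : ℝ) + 1 / 2)}

/-- The times `t ≥ 1` from which on the confidence width is small compared with the gap `δ`. -/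
def goodTimes (K : ℕ) (ε ρ q L δ : ℝ) : Set ℕ :=
  {t | 1 ≤ t ∧ ∀ s : ℕ, t ≤ s →
    (2 * √(2 * Real.exp 1 * Real.log s) + 32) / √(ρ * s * ε) ≤
      1 / 16 * (δ / (2 * K * L)) ^ (1 / q)}

/-- `T₀(ε)`: the first such time, `∞` if there is none. -/
def T0 (K : ℕ) (ε ρ q L δ : ℝ) : ENNReal := ⨅ t ∈ goodTimes K ε ρ q L δ, (t : ENNReal)

/-- `T(ε) = (2 / ε) (T₀(ε) - 1)`. -/
def Tthr (K : ℕ) (ε ρ q L δ : ℝ) : ENNReal :=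
  ENNReal.ofReal (2 / ε) * (T0 K ε ρ q L δ - 1)

/-! ## The algorithms

A path of the interaction is given by the arms `A 0, A 1, …` and the rewards `X 0, X 1, …` of the
successive rounds; after `t` rounds the learner has seen `A s, X s` for `s < t`. -/

/-- `τ_t(i)`: how often arm `i` was selected in the first `t` rounds. -/
def pulls {K : ℕ} (A : ℕ → Fin K) (t : ℕ) (i : Fin K) : ℕ :=
  ((Finset.range t).filter fun s => A s = i).card

/-- The empirical distribution function of arm `i` after `t` rounds. -/
def empCDF {K : ℕ} (A : ℕ → Fin K) (X : ℕ → ℝ) (t : ℕ) (i : Fin K) (x : ℝ) : ℝ :=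
  (((Finset.range t).filter fun s => A s = i ∧ X s ≤ x).card : ℝ) / (pulls A t i : ℝ)

/-- The confidence width `16 (√(2 e log T) + 32) / √(τ_t(i))`. -/
def confWidth {K : ℕ} (T : ℕ) (A : ℕ → Fin K) (t : ℕ) (i : Fin K) : ℝ :=
  16 * ((√(2 * Real.exp 1 * Real.log T) + 32) / √(pulls A t i : ℝ))

/-- The confidence set of arm `i`: the Wasserstein ball in `𝒫(S)` around its empirical law. -/
def confSet {K : ℕ} (S : Set ℝ) (T : ℕ) (A : ℕ → Fin K) (X : ℕ → ℝ) (t : ℕ) (i : Fin K) :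
    Set (Measure ℝ) :=
  {η | FiniteMomentLaw S η ∧ wass (empCDF A X t i) (cdf η) ≤ confWidth T A t i}

/-- The two policies: `U` is PM-UCB-M and `C` is CE-UCB-M. -/
inductive UCBPolicy where
  | U
  | C

/-- The optimistic index of the mixture `a` after `t` rounds. For PM-UCB-M it is the supremum of the
preference metric of `∑ i, a i * η i` over `η i` in the confidence sets; for CE-UCB-M it is the
preference metric of the empirical mixture plus a bonus. -/
def ucbIndex {K : ℕ} (π : UCBPolicy) (h : ℝ → ℝ) (S : Set ℝ) (q L : ℝ) (T : ℕ)
    (A : ℕ → Fin K) (X : ℕ → ℝ) (t : ℕ) (a : Fin K → ℝ) : ℝ :=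
  match π with
  | .U => sSup {u : ℝ | ∃ η : Fin K → Measure ℝ, (∀ i, η i ∈ confSet S T A X t i) ∧
      u = prefMetric h (mix a (armCDF η))}
  | .C => prefMetric h (mix a (empCDF A X t)) + L * ∑ i, (a i * confWidth T A t i) ^ q

/-- The maximizers of the optimistic index over the discretized simplex. -/
def optimistic {K : ℕ} (π : UCBPolicy) (h : ℝ → ℝ) (S : Set ℝ) (q L ε : ℝ) (T : ℕ)
    (A : ℕ → Fin K) (X : ℕ → ℝ) (t : ℕ) : Set (Fin K → ℝ) :=
  {a | a ∈ grid K ε ∧ ∀ b ∈ grid K ε, ucbIndex π h S q L T A X t b ≤ ucbIndex π h S q L T A X t a}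

/-- The number `⌈ρ T ε / 4⌉` of initial samples of each arm. -/
def explore (ε ρ : ℝ) (T : ℕ) : ℕ := ⌈ρ * T * ε / 4⌉₊

/-- The path `(A, X)` with estimates `a` of the mixing coefficients is a run of the policy `π` up to
the horizon `T`. Ties are broken arbitrarily, except that the previous estimate is kept for as long
as it is still optimal. -/
structure IsRun {K : ℕ} (π : UCBPolicy) (h : ℝ → ℝ) (S : Set ℝ) (q L ε ρ : ℝ) (T : ℕ)
    (A : ℕ → Fin K) (X : ℕ → ℝ) (a : ℕ → Fin K → ℝ) : Prop where
  /-- each arm is sampled `N` times in the first `K N` rounds -/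
  exploration : ∀ i, pulls A (K * explore ε ρ T) i = explore ε ρ T
  /-- the estimate maximizes the optimistic index -/
  estimate : ∀ t, K * explore ε ρ T ≤ t → t ≤ T → a t ∈ optimistic π h S q L ε T A X t
  /-- the previous estimate is kept if it is still a maximizer -/
  sticky : ∀ t, K * explore ε ρ T ≤ t → t + 1 ≤ T →
    a t ∈ optimistic π h S q L ε T A X (t + 1) → a (t + 1) = a t
  /-- the next arm is a most under-sampled one -/
  tracking : ∀ t, K * explore ε ρ T ≤ t → t < T →
    ∀ j, (t : ℝ) * a t j - pulls A t j ≤ (t : ℝ) * a t (A t) - pulls A t (A t)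

/-! ## The stochastic bandit and the regret -/

/-- `Y i n` is the reward of the `n`-th selection of arm `i` (counted from `0`): all these rewards
are independent and `Y i n` has law `ν i`. -/
structure IsRewardTable {K : ℕ} {Ω : Type*} [MeasurableSpace Ω] (P : Measure Ω)
    (ν : Fin K → Measure ℝ) (Y : Fin K → ℕ → Ω → ℝ) : Prop where
  measurable : ∀ i n, Measurable (Y i n)
  law : ∀ i n, P.map (Y i n) = ν i
  indep : iIndepFun (fun p : Fin K × ℕ => Y p.1 p.2) P

/-- The reward received in round `s` when the arms `A` are selected. -/
def reward {K : ℕ} {Ω : Type*} (Y : Fin K → ℕ → Ω → ℝ) (A : ℕ → Ω → Fin K) (ω : Ω) (s : ℕ) : ℝ :=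
  Y (A s ω) (pulls (fun r => A r ω) s (A s ω)) ω

/-- The regret at horizon `T`, relative to the optimal mixing coefficients `αstar`. -/
def regret {K : ℕ} {Ω : Type*} [MeasurableSpace Ω] (P : Measure Ω) (h : ℝ → ℝ)
    (ν : Fin K → Measure ℝ) (αstar : Fin K → ℝ) (A : ℕ → Ω → Fin K) (T : ℕ) : ℝ :=
  V h ν αstar - ∫ ω, V h ν (fun i => (pulls (fun r => A r ω) T i : ℝ) / T) ∂P

end

end PMBandit

/-!
Each confidence width exceeds the Wasserstein distance of the empirical law from the true law of its
arm, simultaneously for all arms and all sample sizes up to `T`, except on an event of probability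
at most `1 / T` (`IsRewardTable.exists_accurate`). The distance `W₁` of the empirical law of `n`
samples from the law of the arm is a `1 / n`-Lipschitz function of each sample. Integrating out one
sample at a time, and comparing a Lipschitz function of a sub-Gaussian variable with the identity by
symmetrization, shows that such a function has sub-Gaussian upper deviations from its mean
(`CoordLipschitz.measure_ge_le`). The mean is at most `∫ √(F (1 - F) / n)`, which is `O (1 / √n)`
(`integral_wass_empDist_le`).

Outside of that event, Hölder continuity shows that for either policy the optimistic index of a grid
point `b` lies between `V b` and `V b` plus twice a bonus (`V_le_ucbIndex_and_ucbIndex_le`). If the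
claimed rate is less than `1`, then after the exploration phase the condition `T > T(ε)` makes twice
the bonus smaller than the gap between the best and the second best grid point, so that the best grid
point `a₁` is the only maximizer of the index, in every round (`eq_of_mem_optimistic`). The algorithm
then tracks a constant target, an arm is never over-sampled by more than one selection, and the
proportions `τ_T / T` are within `ℓ₁` distance `2 K / T` of `a₁` (`sum_abs_sub_le_of_accurate`).
Hölder continuity turns this into a bound for the loss, and the exceptional event costs at most its
probability times the Hölder bound for the loss of two arbitrary mixtures. Both contributions are
small multiples of the claimed rate. If the rate is at least `1`, the bound for the loss of two
arbitrary mixtures suffices.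
-/

namespace PMBandit

open MeasureTheory ProbabilityTheory

noncomputable section

/-! ### Distribution functions of laws with finite first moment -/

/-- The distribution function `t ↦ 1[x ≤ t]` of the point mass at `x`. -/
def step (x t : ℝ) : ℝ := if x ≤ t then 1 else 0

lemma step_nonneg (x t : ℝ) : 0 ≤ step x t := by unfold step; split_ifs <;> norm_num

lemma step_le_one (x t : ℝ) : step x t ≤ 1 := by unfold step; split_ifs <;> norm_num

lemma measurable_step : Measurable (fun p : ℝ × ℝ => step p.1 p.2) :=
  Measurable.ite (measurableSet_le measurable_fst measurable_snd) measurable_const measurable_const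

lemma abs_step_sub_step (x y t : ℝ) :
    |step x t - step y t| = (Set.Ico (min x y) (max x y)).indicator 1 t := by
  unfold step Set.indicator
  simp only [Set.mem_Ico, min_le_iff, lt_max_iff, Pi.one_apply]
  split_ifs <;> first | (norm_num; done) | (exfalso; grind)

lemma integrable_step_sub_step (x y : ℝ) : Integrable (fun t => step x t - step y t) := by
  have hm : ∀ z, Measurable (step z) := fun z =>
    measurable_step.comp (by fun_prop : Measurable fun t : ℝ => (z, t))
  refine (integrable_norm_iff ((hm x).sub (hm y)).aestronglyMeasurable).1 ?_
  change Integrable (fun t => |step x t - step y t|)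
  simp only [abs_step_sub_step]
  exact (integrable_indicator_iff measurableSet_Ico).2
    (integrableOn_const (by simp) (by simp))

lemma integral_abs_step_sub_step (x y : ℝ) : ∫ t, |step x t - step y t| = |x - y| := by
  simp only [abs_step_sub_step]
  rw [integral_indicator_one measurableSet_Ico]
  simp [max_sub_min_eq_abs, abs_sub_comm]

lemma cdf_dirac (x t : ℝ) : cdf (Measure.dirac x) t = step x t := by
  rw [cdf_eq_real, measureReal_def, Measure.dirac_apply' _ measurableSet_Iic]
  unfold step Set.indicator
  simp only [Set.mem_Iic]
  split_ifs <;> simp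

lemma cdf_eq_integral_step (η : Measure ℝ) [IsProbabilityMeasure η] (t : ℝ) :
    cdf η t = ∫ x, step x t ∂η := by
  have : (fun x => step x t) = (Set.Iic t).indicator 1 := by
    ext x; simp [step, Set.indicator]
  rw [this, integral_indicator_one measurableSet_Iic, cdf_eq_real]

lemma integrable_step_left (η : Measure ℝ) [IsProbabilityMeasure η] (t : ℝ) :
    Integrable (fun x => step x t) η := by
  refine Integrable.of_bound (measurable_step.comp
    (by fun_prop : Measurable fun x : ℝ => (x, t))).aestronglyMeasurable 1 (.of_forall fun x => ?_)
  rw [Real.norm_eq_abs, abs_of_nonneg (step_nonneg _ _)]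
  exact step_le_one _ _

lemma integrable_cdf_sub_step {S : Set ℝ} {η : Measure ℝ} (hη : FiniteMomentLaw S η) :
    Integrable (fun t => cdf η t - step 0 t) := by
  have := hη.prob
  have h : Integrable (fun p : ℝ × ℝ => step p.1 p.2 - step 0 p.2) (η.prod volume) := by
    refine (integrable_prod_iff ?_).2 ⟨.of_forall fun x => integrable_step_sub_step x 0, ?_⟩
    · exact (measurable_step.sub (measurable_step.comp
        (by fun_prop : Measurable fun p : ℝ × ℝ => ((0 : ℝ), p.2)))).aestronglyMeasurable
    · simp only [Real.norm_eq_abs, integral_abs_step_sub_step, sub_zero]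
      exact hη.moment.abs
  refine h.integral_prod_right.congr (.of_forall fun t => ?_)
  simp only
  rw [integral_sub (integrable_step_left η t) (integrable_const _), ← cdf_eq_integral_step]
  simp

lemma integrable_cdf_sub_cdf {S S' : Set ℝ} {η ζ : Measure ℝ} (hη : FiniteMomentLaw S η)
    (hζ : FiniteMomentLaw S' ζ) : Integrable (fun t => cdf η t - cdf ζ t) := by
  refine ((integrable_cdf_sub_step hη).sub (integrable_cdf_sub_step hζ)).congr
    (.of_forall fun t => ?_)
  simp

lemma finiteMomentLaw_dirac {S : Set ℝ} {x : ℝ} (hx : x ∈ S) :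
    FiniteMomentLaw S (Measure.dirac x) where
  prob := inferInstance
  support := by rw [ae_dirac_eq]; exact hx
  moment := integrable_dirac (by simp)

/-! ### Mixtures -/

/-- The mixture `∑ i, a i • η i` of laws. -/
def mixLaw {ι : Type*} [Fintype ι] (a : ι → ℝ) (η : ι → Measure ℝ) : Measure ℝ :=
  ∑ i, ENNReal.ofReal (a i) • η i

lemma finiteMomentLaw_mixLaw {ι : Type*} [Fintype ι] {S : Set ℝ} {a : ι → ℝ}
    (ha : a ∈ stdSimplex ℝ ι) {η : ι → Measure ℝ} (hη : ∀ i, FiniteMomentLaw S (η i)) :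
    FiniteMomentLaw S (mixLaw a η) where
  prob := by
    have := fun i => (hη i).prob
    refine ⟨?_⟩
    simp only [mixLaw, Measure.coe_finsetSum, Finset.sum_apply, Measure.smul_apply, measure_univ,
      smul_eq_mul, mul_one]
    rw [← ENNReal.ofReal_sum_of_nonneg fun i _ => ha.1 i, ha.2, ENNReal.ofReal_one]
  support := by
    rw [ae_iff]
    simp only [mixLaw, Measure.coe_finsetSum, Finset.sum_apply, Measure.smul_apply, smul_eq_mul]
    exact Finset.sum_eq_zero fun i _ => by
      rw [ae_iff.1 (hη i).support, mul_zero]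
  moment := integrable_finsetSum_measure.2 fun i _ =>
    (hη i).moment.smul_measure ENNReal.ofReal_ne_top

lemma cdf_mixLaw {ι : Type*} [Fintype ι] {S : Set ℝ} {a : ι → ℝ}
    (ha : a ∈ stdSimplex ℝ ι) {η : ι → Measure ℝ} (hη : ∀ i, FiniteMomentLaw S (η i)) (t : ℝ) :
    cdf (mixLaw a η) t = ∑ i, a i * cdf (η i) t := by
  have := fun i => (hη i).prob
  have := (finiteMomentLaw_mixLaw ha hη).prob
  rw [cdf_eq_real, measureReal_def]
  simp only [mixLaw, Measure.coe_finsetSum, Finset.sum_apply, Measure.smul_apply, smul_eq_mul]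
  rw [ENNReal.toReal_sum fun i _ => ENNReal.mul_ne_top ENNReal.ofReal_ne_top (measure_ne_top _ _)]
  refine Finset.sum_congr rfl fun i _ => ?_
  rw [ENNReal.toReal_mul, ENNReal.toReal_ofReal (ha.1 i), cdf_eq_real, measureReal_def]

/-! ### The Wasserstein distance -/

lemma wass_nonneg (Q R : ℝ → ℝ) : 0 ≤ wass Q R := integral_nonneg fun _ => abs_nonneg _

lemma wass_comm (Q R : ℝ → ℝ) : wass Q R = wass R Q := by simp only [wass, abs_sub_comm]

lemma wass_triangle {Q R O : ℝ → ℝ} (h₁ : Integrable (fun t => Q t - R t))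
    (h₂ : Integrable (fun t => R t - O t)) : wass Q O ≤ wass Q R + wass R O := by
  have h₃ : Integrable (fun t => Q t - O t) := (h₁.add h₂).congr (.of_forall fun t => by simp)
  unfold wass
  rw [← integral_add h₁.abs h₂.abs]
  exact integral_mono h₃.abs (h₁.abs.add h₂.abs) fun t => abs_sub_le _ _ _

/-- The Wasserstein distance of two mixtures with the same coefficients is at most the mixture of
the distances. -/
lemma wass_sum_le {ι : Type*} [Fintype ι] {a : ι → ℝ} (ha : ∀ i, 0 ≤ a i) {Q R : ι → ℝ → ℝ}
    (h : ∀ i, Integrable (fun t => Q i t - R i t)) :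
    wass (fun t => ∑ i, a i * Q i t) (fun t => ∑ i, a i * R i t) ≤ ∑ i, a i * wass (Q i) (R i) := by
  unfold wass
  simp only [← integral_const_mul]
  rw [← integral_finsetSum _ fun i _ => (h i).abs.const_mul _]
  have hi : Integrable (fun t => ∑ i, a i * Q i t - ∑ i, a i * R i t) :=
    (integrable_finsetSum Finset.univ fun i _ => (h i).const_mul (a i)).congr
      (.of_forall fun t => by simp [mul_sub])
  refine integral_mono hi.abs (integrable_finsetSum _ fun i _ => (h i).abs.const_mul _) fun t => ?_
  simp only [← Finset.sum_sub_distrib, ← mul_sub]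
  refine (Finset.abs_sum_le_sum_abs _ _).trans (Finset.sum_le_sum fun i _ => ?_)
  rw [abs_mul, abs_of_nonneg (ha i)]

/-- Mixtures depend on their coefficients in a Lipschitz way: since the coefficients of both have
the same sum, a fixed arm may be subtracted from all arms, which makes everything integrable. -/
lemma exists_wass_mix_le {K : ℕ} {S : Set ℝ} {ν : Fin K → Measure ℝ}
    (hν : ∀ i, FiniteMomentLaw S (ν i)) :
    ∃ C, ∀ α ∈ stdSimplex ℝ (Fin K), ∀ β ∈ stdSimplex ℝ (Fin K),
      wass (mix α (armCDF ν)) (mix β (armCDF ν)) ≤ C * ∑ i, |α i - β i| := by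
  set D : Fin K → ℝ := fun i => ∫ t, |cdf (ν i) t - step 0 t|
  have hD : ∀ i, 0 ≤ D i := fun i => integral_nonneg fun _ => abs_nonneg _
  refine ⟨∑ i, D i, fun α hα β hβ => ?_⟩
  have hint := fun i => integrable_cdf_sub_step (hν i)
  have key : ∀ t, mix α (armCDF ν) t - mix β (armCDF ν) t
      = ∑ i, (α i - β i) * (cdf (ν i) t - step 0 t) := by
    intro t
    simp only [mix, armCDF, mul_sub, Finset.sum_sub_distrib, ← Finset.sum_mul, sub_mul, hα.2, hβ.2]
    ring
  calc wass (mix α (armCDF ν)) (mix β (armCDF ν))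
      ≤ ∫ t, ∑ i, |α i - β i| * |cdf (ν i) t - step 0 t| := by
        unfold wass
        simp only [key]
        refine integral_mono (integrable_finsetSum _ fun i _ => (hint i).const_mul _).abs
          (integrable_finsetSum _ fun i _ => (hint i).abs.const_mul _) fun t => ?_
        refine (Finset.abs_sum_le_sum_abs _ _).trans_eq ?_
        simp [abs_mul]
    _ = ∑ i, |α i - β i| * D i := by
        rw [integral_finsetSum _ fun i _ => (hint i).abs.const_mul _]
        simp only [integral_const_mul, D]
    _ ≤ ∑ i, |α i - β i| * ∑ j, D j := Finset.sum_le_sum fun i _ =>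
        mul_le_mul_of_nonneg_left (Finset.single_le_sum (fun j _ => hD j) (Finset.mem_univ i))
          (abs_nonneg _)
    _ = _ := by rw [← Finset.sum_mul, mul_comm]

lemma wassRatio_nonneg {K : ℕ} (ν : Fin K → Measure ℝ) : 0 ≤ wassRatio ν := by
  refine Real.sSup_nonneg ?_
  rintro w ⟨α, -, β, -, -, rfl⟩
  exact div_nonneg (wass_nonneg _ _) (Finset.sum_nonneg fun _ _ => abs_nonneg _)

lemma wass_mix_le_wassRatio {K : ℕ} {S : Set ℝ} {ν : Fin K → Measure ℝ}
    (hν : ∀ i, FiniteMomentLaw S (ν i)) {α β : Fin K → ℝ} (hα : α ∈ stdSimplex ℝ (Fin K))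
    (hβ : β ∈ stdSimplex ℝ (Fin K)) :
    wass (mix α (armCDF ν)) (mix β (armCDF ν)) ≤ wassRatio ν * ∑ i, |α i - β i| := by
  by_cases hne : α = β
  · subst hne
    simp [wass]
  have pos : ∀ {α β : Fin K → ℝ}, α ≠ β → 0 < ∑ i, |α i - β i| := fun {α β} h => by
    obtain ⟨i, hi⟩ := Function.ne_iff.1 h
    exact Finset.sum_pos' (fun _ _ => abs_nonneg _)
      ⟨i, Finset.mem_univ i, abs_pos.2 (sub_ne_zero.2 hi)⟩
  rw [← div_le_iff₀ (pos hne)]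
  obtain ⟨C, hC⟩ := exists_wass_mix_le hν
  refine le_csSup ⟨C, ?_⟩ ⟨α, hα, β, hβ, hne, rfl⟩
  rintro w ⟨α', hα', β', hβ', hne', rfl⟩
  exact (div_le_iff₀ (pos hne')).2 (hC α' hα' β' hβ')

/-- Hölder continuity in the form used throughout: `V` against the preference metric of a mixture of
arbitrary laws in `𝒫(S)`. -/
lemma abs_V_sub_prefMetric_mix_le {K : ℕ} {S : Set ℝ} {h : ℝ → ℝ} {ν η : Fin K → Measure ℝ}
    {q L : ℝ} (h_holder : IsHolderPM h S ν q L) {α β : Fin K → ℝ}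
    (hα : α ∈ stdSimplex ℝ (Fin K)) (hβ : β ∈ stdSimplex ℝ (Fin K))
    (hη : ∀ i, FiniteMomentLaw S (η i)) :
    |V h ν α - prefMetric h (mix β (armCDF η))|
      ≤ L * wass (mix α (armCDF ν)) (mix β (armCDF η)) ^ q := by
  have hc : (cdf (mixLaw β η) : ℝ → ℝ) = mix β (armCDF η) := funext (cdf_mixLaw hβ hη)
  have := (h_holder α hα _ (finiteMomentLaw_mixLaw hβ hη)).2
  rwa [hc] at this

lemma abs_V_sub_V_le {K : ℕ} {S : Set ℝ} {h : ℝ → ℝ} {ν : Fin K → Measure ℝ}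
    {q L : ℝ} (hq : 0 < q) (hL : 0 < L) (h_holder : IsHolderPM h S ν q L)
    (hν : ∀ i, FiniteMomentLaw S (ν i)) {α β : Fin K → ℝ}
    (hα : α ∈ stdSimplex ℝ (Fin K)) (hβ : β ∈ stdSimplex ℝ (Fin K)) :
    |V h ν α - V h ν β| ≤ L * (wassRatio ν * ∑ i, |α i - β i|) ^ q :=
  (abs_V_sub_prefMetric_mix_le h_holder hα hβ hν).trans <| mul_le_mul_of_nonneg_left
    (Real.rpow_le_rpow (wass_nonneg _ _) (wass_mix_le_wassRatio hν hα hβ) hq.le) hL.le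

/-! ### Concentration of coordinatewise Lipschitz functions of sub-Gaussian samples -/

lemma IsOneSubGaussian.integrable_exp_mul {η : Measure ℝ} (hη : IsOneSubGaussian η) (t : ℝ) :
    Integrable (fun x => Real.exp (t * x)) η := by
  refine ((HasSubgaussianMGF.integrable_exp_mul hη t).mul_const
    (Real.exp (t * ∫ y, y ∂η))).congr (.of_forall fun x => ?_)
  simp only
  rw [← Real.exp_add]
  ring_nf

lemma IsOneSubGaussian.integral_exp_mul_le {η : Measure ℝ} (hη : IsOneSubGaussian η) (t : ℝ) :
    ∫ x, Real.exp (t * x) ∂η ≤ Real.exp (t * (∫ y, y ∂η) + t ^ 2 / 2) := by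
  have h := HasSubgaussianMGF.mgf_le hη t
  rw [mgf] at h
  have he : ∀ x, Real.exp (t * x)
      = Real.exp (t * (x - ∫ y, y ∂η)) * Real.exp (t * ∫ y, y ∂η) := fun x => by
    rw [← Real.exp_add]; ring_nf
  rw [integral_congr_ae (.of_forall he), integral_mul_const, Real.exp_add, mul_comm]
  simpa using mul_le_mul_of_nonneg_left h (Real.exp_pos (t * ∫ y, y ∂η)).le

lemma integrable_of_abs_sub_le {η : Measure ℝ} [IsProbabilityMeasure η]
    (hη : Integrable (fun x => x) η) {g : ℝ → ℝ} {c : ℝ} (hg : Continuous g)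
    (hgc : ∀ x y, |g x - g y| ≤ c * |x - y|) : Integrable g η := by
  refine ((hη.abs.const_mul c).add (integrable_const |g 0|)).mono' hg.aestronglyMeasurable
    (.of_forall fun x => ?_)
  have h1 := hgc x 0
  rw [sub_zero] at h1
  have h2 := abs_sub_abs_le_abs_sub (g x) (g 0)
  simp only [Pi.add_apply, Real.norm_eq_abs]
  linarith

lemma IsOneSubGaussian.integrable_exp_mul_of_abs_sub_le {η : Measure ℝ}
    (hη : IsOneSubGaussian η) {g : ℝ → ℝ} {c : ℝ} (hg : Continuous g)
    (hgc : ∀ x y, |g x - g y| ≤ c * |x - y|) (l : ℝ) :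
    Integrable (fun x => Real.exp (l * g x)) η := by
  have hi := ((hη.integrable_exp_mul (|l| * c)).add (hη.integrable_exp_mul (-(|l| * c)))).const_mul
    (Real.exp (|l| * |g 0|))
  refine hi.mono' (by fun_prop) (.of_forall fun x => ?_)
  have h1 := hgc x 0
  rw [sub_zero] at h1
  have h2 : l * g x ≤ |l| * |g 0| + |l| * c * |x| := by
    have h3 := abs_sub_abs_le_abs_sub (g x) (g 0)
    have h4 : l * g x ≤ |l| * |g x| := by rw [← abs_mul]; exact le_abs_self _
    nlinarith [abs_nonneg l]
  rw [Real.norm_eq_abs, abs_of_pos (Real.exp_pos _)]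
  refine (Real.exp_le_exp.2 h2).trans ?_
  rw [Real.exp_add]
  refine mul_le_mul_of_nonneg_left ?_ (Real.exp_pos _).le
  simp only [Pi.add_apply]
  rcases abs_cases x with ⟨hx, -⟩ | ⟨hx, -⟩ <;> rw [hx]
  · linarith [Real.exp_pos (-(|l| * c) * x)]
  · rw [show |l| * c * -x = -(|l| * c) * x by ring]
    linarith [Real.exp_pos (|l| * c * x)]

/-- Exponential moments of a Lipschitz function of one sub-Gaussian variable. By Jensen's inequality
`exp (-l * ∫ g) ≤ ∫ exp (-l * g)`, and in the resulting double integral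
`2 * ∫ exp (l * g) * ∫ exp (-l * g) = ∫∫ 2 * cosh (l * (g x - g y))` the function `g` may be
replaced by `c` times the identity, because `cosh` is even and increasing on the positive half-line. -/
lemma IsOneSubGaussian.integral_exp_mul_lipschitz_le {η : Measure ℝ} [IsProbabilityMeasure η]
    (hη : IsOneSubGaussian η) (hm : Integrable (fun x => x) η) {g : ℝ → ℝ} {c : ℝ}
    (hg : Continuous g) (hgc : ∀ x y, |g x - g y| ≤ c * |x - y|) (l : ℝ) :
    ∫ x, Real.exp (l * g x) ∂η ≤ Real.exp (l ^ 2 * c ^ 2 + l * ∫ x, g x ∂η) := by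
  have hgi := fun l => hη.integrable_exp_mul_of_abs_sub_le hg hgc l
  have hxi := hη.integrable_exp_mul
  have jensen : Real.exp (-(l * ∫ x, g x ∂η)) ≤ ∫ x, Real.exp (-l * g x) ∂η := by
    have := convexOn_exp.map_integral_le Real.continuous_exp.continuousOn isClosed_univ
      (by simp) ((integrable_of_abs_sub_le hm hg hgc).const_mul (-l)) (hgi (-l))
    rwa [integral_const_mul, neg_mul] at this
  have prod_eq : ∀ (u : ℝ → ℝ) (k : ℝ),
      (∫ x, Real.exp (k * u x) ∂η) * ∫ x, Real.exp (-k * u x) ∂η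
        = ∫ p, Real.exp (k * u p.1) * Real.exp (-k * u p.2) ∂(η.prod η) := fun u k =>
    (integral_prod_mul _ _).symm
  have sym : (∫ x, Real.exp (l * g x) ∂η) * ∫ x, Real.exp (-l * g x) ∂η
      ≤ (∫ x, Real.exp (l * c * x) ∂η) * ∫ x, Real.exp (-(l * c) * x) ∂η := by
    have i1 := (hgi l).mul_prod (hgi (-l))
    have i2 := (hgi (-l)).mul_prod (hgi l)
    have j1 := (hxi (l * c)).mul_prod (hxi (-(l * c)))
    have j2 := (hxi (-(l * c))).mul_prod (hxi (l * c))
    have e1 := prod_eq g l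
    have e2 := prod_eq g (-l)
    have f1 := prod_eq id (l * c)
    have f2 := prod_eq id (-(l * c))
    simp only [neg_neg, id] at e1 e2 f1 f2
    have : (∫ p, Real.exp (l * g p.1) * Real.exp (-l * g p.2) ∂(η.prod η))
          + ∫ p, Real.exp (-l * g p.1) * Real.exp (l * g p.2) ∂(η.prod η)
        ≤ (∫ p, Real.exp (l * c * p.1) * Real.exp (-(l * c) * p.2) ∂(η.prod η))
          + ∫ p, Real.exp (-(l * c) * p.1) * Real.exp (l * c * p.2) ∂(η.prod η) := by
      rw [← integral_add i1 i2, ← integral_add j1 j2]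
      refine integral_mono (i1.add i2) (j1.add j2) fun p => ?_
      simp only [← Real.exp_add]
      have hc : Real.cosh (l * (g p.1 - g p.2)) ≤ Real.cosh (l * c * (p.1 - p.2)) := by
        rw [Real.cosh_le_cosh, abs_mul, abs_mul, abs_mul, mul_assoc]
        refine mul_le_mul_of_nonneg_left ((hgc _ _).trans ?_) (abs_nonneg l)
        exact mul_le_mul_of_nonneg_right (le_abs_self c) (abs_nonneg _)
      rw [Real.cosh_eq, Real.cosh_eq] at hc
      ring_nf at hc ⊢
      linarith
    rw [← e1, ← e2, ← f1, ← f2] at this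
    linarith
  have hA : 0 ≤ ∫ x, Real.exp (l * g x) ∂η := integral_nonneg fun _ => (Real.exp_pos _).le
  have hid : (∫ x, Real.exp (l * c * x) ∂η) * ∫ x, Real.exp (-(l * c) * x) ∂η
      ≤ Real.exp (l ^ 2 * c ^ 2) := by
    refine (mul_le_mul (hη.integral_exp_mul_le _) (hη.integral_exp_mul_le _)
      (integral_nonneg fun _ => (Real.exp_pos _).le) (Real.exp_pos _).le).trans_eq ?_
    rw [← Real.exp_add]
    ring_nf
  have h := (mul_le_mul_of_nonneg_left jensen hA).trans (sym.trans hid)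
  rw [Real.exp_neg, ← div_eq_mul_inv, div_le_iff₀ (Real.exp_pos _)] at h
  rwa [Real.exp_add]

/-- `f` is Lipschitz with constant `c` for the `ℓ₁` distance. -/
def CoordLipschitz {n : ℕ} (c : ℝ) (f : (Fin n → ℝ) → ℝ) : Prop :=
  ∀ x y, |f x - f y| ≤ c * ∑ i, |x i - y i|

lemma CoordLipschitz.continuous {n : ℕ} {c : ℝ} {f : (Fin n → ℝ) → ℝ} (hf : CoordLipschitz c f) :
    Continuous f := by
  rw [continuous_iff_continuousAt]
  intro y
  rw [ContinuousAt, tendsto_iff_norm_sub_tendsto_zero]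
  refine squeeze_zero (fun _ => norm_nonneg _) (fun x => hf x y) ?_
  have : Continuous fun x : Fin n → ℝ => c * ∑ i, |x i - y i| := by fun_prop
  simpa using this.tendsto y

lemma CoordLipschitz.integrable {n : ℕ} {c : ℝ} {f : (Fin n → ℝ) → ℝ} (hf : CoordLipschitz c f)
    {η : Measure ℝ} [IsProbabilityMeasure η] (hη : Integrable (fun x => x) η) :
    Integrable f (Measure.pi fun _ => η) := by
  have hi : Integrable (fun x : Fin n → ℝ => c * ∑ i, |x i| + |f 0|) (Measure.pi fun _ => η) := by
    refine ((integrable_finsetSum _ fun i _ => ?_).const_mul c).add (integrable_const _)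
    exact integrable_comp_eval (f := fun x => |x|) hη.abs
  refine hi.mono' hf.continuous.aestronglyMeasurable (.of_forall fun x => ?_)
  have h1 := hf x 0
  simp only [Pi.zero_apply, sub_zero] at h1
  have h2 := abs_sub_abs_le_abs_sub (f x) (f 0)
  rw [Real.norm_eq_abs]
  linarith

/-- Exponential moments of a coordinatewise Lipschitz function of independent sub-Gaussian
variables, by integrating out one variable at a time. -/
lemma CoordLipschitz.lintegral_exp_le {η : Measure ℝ} [IsProbabilityMeasure η]
    (hη : IsOneSubGaussian η) (hm : Integrable (fun x => x) η) {c : ℝ} (l : ℝ) :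
    ∀ {n : ℕ} {f : (Fin n → ℝ) → ℝ}, CoordLipschitz c f →
      ∫⁻ x, ENNReal.ofReal (Real.exp (l * f x)) ∂(Measure.pi fun _ => η)
        ≤ ENNReal.ofReal (Real.exp (n * (l ^ 2 * c ^ 2) +
            l * ∫ x, f x ∂(Measure.pi fun _ => η))) := by
  intro n
  induction n with
  | zero =>
    intro f _
    have hf : ∀ x, f x = f 0 := fun x => congrArg f (Subsingleton.elim _ _)
    simp [hf]
  | succ n ih =>
    intro f hf
    have mp := (measurePreserving_piFinSuccAbove (fun _ : Fin (n + 1) => η) 0).symm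
    set e := (MeasurableEquiv.piFinSuccAbove (fun _ : Fin (n + 1) => ℝ) 0).symm
    have he : ∀ p q : ℝ × (Fin n → ℝ),
        ∑ i, |e p i - e q i| = |p.1 - q.1| + ∑ i, |p.2 i - q.2 i| := by
      intro p q
      rw [Fin.sum_univ_succ]
      simp [e, MeasurableEquiv.piFinSuccAbove]
    have hfc : Continuous fun p => f (e p) := by
      refine hf.continuous.comp (continuous_pi fun i => ?_)
      refine Fin.cases ?_ (fun j => ?_) i
      · simpa [e, MeasurableEquiv.piFinSuccAbove] using continuous_fst
      · have : Continuous fun p : ℝ × (Fin n → ℝ) => p.2 j := by fun_prop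
        simpa [e, MeasurableEquiv.piFinSuccAbove] using this
    have hfm : Measurable fun p => ENNReal.ofReal (Real.exp (l * f (e p)))  :=
      ENNReal.measurable_ofReal.comp (Real.measurable_exp.comp (hfc.measurable.const_mul l))
    have hsec : ∀ y, Continuous fun x => f (e (x, y)) := fun y => hfc.comp (by fun_prop)
    have hlip : ∀ y x x', |f (e (x, y)) - f (e (x', y))| ≤ c * |x - x'| := fun y x x' => by
      simpa [he] using hf (e (x, y)) (e (x', y))
    have hint := fun y => integrable_of_abs_sub_le hm (hsec y) (hlip y)
    have hg : CoordLipschitz c fun y => ∫ x, f (e (x, y)) ∂η := by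
      intro y y'
      rw [← integral_sub (hint y) (hint y'), ← Real.norm_eq_abs]
      refine (norm_integral_le_of_norm_le_const (C := c * ∑ i, |y i - y' i|)
        (.of_forall fun x => ?_)).trans_eq ?_
      · simpa [he] using hf (e (x, y)) (e (x, y'))
      · rw [probReal_univ, mul_one]
    have hfi : Integrable (fun p => f (e p)) (η.prod (Measure.pi fun _ : Fin n => η)) :=
      (mp.integrable_comp_emb e.measurableEmbedding).2 (hf.integrable hm)
    rw [← mp.lintegral_comp_emb e.measurableEmbedding, ← mp.integral_comp e.measurableEmbedding,
      lintegral_prod_symm' _ hfm, integral_prod_symm _ hfi]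
    calc ∫⁻ y, ∫⁻ x, ENNReal.ofReal (Real.exp (l * f (e (x, y)))) ∂η ∂(Measure.pi fun _ => η)
        ≤ ∫⁻ y, ENNReal.ofReal (Real.exp (l ^ 2 * c ^ 2)) *
            ENNReal.ofReal (Real.exp (l * ∫ x, f (e (x, y)) ∂η)) ∂(Measure.pi fun _ => η) := by
          refine lintegral_mono fun y => ?_
          rw [← ofReal_integral_eq_lintegral_ofReal
            (hη.integrable_exp_mul_of_abs_sub_le (hsec y) (hlip y) l)
            (.of_forall fun _ => (Real.exp_pos _).le),
            ← ENNReal.ofReal_mul (Real.exp_pos _).le, ← Real.exp_add]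
          exact ENNReal.ofReal_le_ofReal
            (hη.integral_exp_mul_lipschitz_le hm (hsec y) (hlip y) l)
      _ ≤ ENNReal.ofReal (Real.exp (l ^ 2 * c ^ 2)) *
            ENNReal.ofReal (Real.exp (n * (l ^ 2 * c ^ 2) +
              l * ∫ y, ∫ x, f (e (x, y)) ∂η ∂(Measure.pi fun _ => η))) := by
          rw [lintegral_const_mul' _ _ ENNReal.ofReal_ne_top]
          gcongr
          exact ih hg
      _ = _ := by
          rw [← ENNReal.ofReal_mul (Real.exp_pos _).le, ← Real.exp_add]
          push_cast
          ring_nf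

/-- A coordinatewise Lipschitz function of independent sub-Gaussian variables exceeds its mean by
`s` with a probability of at most `exp (-s² / (4 n c²))`. -/
lemma CoordLipschitz.measure_ge_le {η : Measure ℝ} [IsProbabilityMeasure η]
    (hη : IsOneSubGaussian η) (hm : Integrable (fun x => x) η) {n : ℕ} (hn : 0 < n) {c : ℝ}
    (hc : 0 < c) {f : (Fin n → ℝ) → ℝ} (hf : CoordLipschitz c f) {s : ℝ} (hs : 0 ≤ s) :
    Measure.pi (fun _ => η) {x | (∫ y, f y ∂(Measure.pi fun _ => η)) + s ≤ f x}
      ≤ ENNReal.ofReal (Real.exp (-(s ^ 2 / (4 * n * c ^ 2)))) := by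
  set m := ∫ y, f y ∂(Measure.pi fun _ => η)
  have hn' : (0 : ℝ) < n := Nat.cast_pos.2 hn
  -- the minimizer of `n * l² * c² - l * s`
  set l := s / (2 * n * c ^ 2) with hl
  have hl0 : 0 ≤ l := by positivity
  have hsub : {x | m + s ≤ f x} ⊆ {x | ENNReal.ofReal (Real.exp (l * (m + s)))
      ≤ ENNReal.ofReal (Real.exp (l * f x))} := fun x hx =>
    ENNReal.ofReal_le_ofReal (Real.exp_le_exp.2 (mul_le_mul_of_nonneg_left hx hl0))
  have hcont := hf.continuous
  refine (measure_mono hsub).trans ((meas_ge_le_lintegral_div (by fun_prop)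
    (ENNReal.ofReal_pos.2 (Real.exp_pos _)).ne' ENNReal.ofReal_ne_top).trans ?_)
  refine (ENNReal.div_le_div_right (hf.lintegral_exp_le hη hm l) _).trans ?_
  rw [← ENNReal.ofReal_div_of_pos (Real.exp_pos _), ← Real.exp_sub]
  refine ENNReal.ofReal_le_ofReal (Real.exp_le_exp.2 (le_of_eq ?_))
  rw [hl]
  field_simp
  ring

/-! ### Wasserstein concentration of empirical distributions -/

/-- The empirical distribution function of the sample `x`. -/
def empDist {n : ℕ} (x : Fin n → ℝ) (t : ℝ) : ℝ := ∑ k, (n : ℝ)⁻¹ * step (x k) t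

lemma uniform_mem_stdSimplex {n : ℕ} (hn : 0 < n) :
    (fun _ => (n : ℝ)⁻¹) ∈ stdSimplex ℝ (Fin n) := by
  refine ⟨fun _ => by positivity, ?_⟩
  have : (n : ℝ) ≠ 0 := by positivity
  simp [this]

lemma exists_law_of_empDist {S : Set ℝ} {n : ℕ} (hn : 0 < n) {x : Fin n → ℝ} (hx : ∀ k, x k ∈ S) :
    ∃ G, FiniteMomentLaw S G ∧ (cdf G : ℝ → ℝ) = empDist x := by
  have hd := fun k => finiteMomentLaw_dirac (hx k)
  refine ⟨_, finiteMomentLaw_mixLaw (uniform_mem_stdSimplex hn) hd, funext fun t => ?_⟩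
  simp only [cdf_mixLaw (uniform_mem_stdSimplex hn) hd, cdf_dirac, empDist]

lemma integrable_empDist_sub_cdf {S : Set ℝ} {η : Measure ℝ} (hη : FiniteMomentLaw S η) {n : ℕ}
    (hn : 0 < n) (x : Fin n → ℝ) : Integrable (fun t => empDist x t - cdf η t) := by
  obtain ⟨G, hG, hGx⟩ := exists_law_of_empDist hn fun k => Set.mem_univ (x k)
  simpa [hGx] using integrable_cdf_sub_cdf hG hη

lemma coordLipschitz_wass_empDist {S : Set ℝ} {η : Measure ℝ} (hη : FiniteMomentLaw S η) {n : ℕ}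
    (hn : 0 < n) : CoordLipschitz (n : ℝ)⁻¹ fun x : Fin n → ℝ => wass (empDist x) (cdf η) := by
  have hone : ∀ x y : Fin n → ℝ, wass (empDist x) (cdf η) - wass (empDist y) (cdf η)
      ≤ (n : ℝ)⁻¹ * ∑ i, |x i - y i| := by
    intro x y
    have hxy : Integrable (fun t => empDist x t - empDist y t) :=
      ((integrable_empDist_sub_cdf hη hn x).sub (integrable_empDist_sub_cdf hη hn y)).congr
        (.of_forall fun t => by simp)
    have h := wass_triangle hxy (integrable_empDist_sub_cdf hη hn y)
    have h' := wass_sum_le (a := fun _ : Fin n => (n : ℝ)⁻¹) (fun _ => by positivity)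
      fun i => integrable_step_sub_step (x i) (y i)
    simp only [wass, integral_abs_step_sub_step, ← Finset.mul_sum] at h' h ⊢
    simp only [empDist, ← Finset.mul_sum] at h ⊢
    linarith
  intro x y
  refine abs_sub_le_iff.2 ⟨hone x y, ?_⟩
  simpa only [abs_sub_comm] using hone y x

lemma sq_integral_abs_le {Ω : Type*} [MeasurableSpace Ω] {P : Measure Ω} [IsProbabilityMeasure P]
    {Z : Ω → ℝ} (hZ : MemLp Z 2 P) : (∫ ω, |Z ω| ∂P) ^ 2 ≤ ∫ ω, Z ω ^ 2 ∂P := by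
  have h := variance_nonneg |Z| P
  rw [variance_eq_sub hZ.abs] at h
  simpa using h

/-- `F (1 - F)` has Gaussian decay around the mean. -/
lemma IsOneSubGaussian.one_sub_cdf_mul_cdf_le {η : Measure ℝ} [IsProbabilityMeasure η]
    (hη : IsOneSubGaussian η) (t : ℝ) :
    (1 - cdf η t) * cdf η t ≤ Real.exp (-(t - ∫ y, y ∂η) ^ 2 / 2) := by
  set m := ∫ y, y ∂η
  have h0 := cdf_nonneg η t
  have h1 := cdf_le_one η t
  rcases le_total m t with h | h
  · have h2 := HasSubgaussianMGF.measure_ge_le hη (sub_nonneg.2 h)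
    have h3 : 1 - cdf η t ≤ η.real {x | t - m ≤ x - m} := by
      rw [cdf_eq_real, ← probReal_compl_eq_one_sub measurableSet_Iic]
      refine measureReal_mono fun x hx => ?_
      simp only [Set.mem_compl_iff, Set.mem_Iic, not_le] at hx
      simpa using hx.le
    simp only [NNReal.coe_one, mul_one] at h2
    nlinarith
  · have h2 := HasSubgaussianMGF.measure_ge_le (HasSubgaussianMGF.neg hη) (sub_nonneg.2 h)
    have h3 : cdf η t ≤ η.real {x | m - t ≤ (-fun x => x - m) x} := by
      rw [cdf_eq_real]
      refine measureReal_mono fun x hx => ?_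
      change m - t ≤ -(x - m)
      linarith [Set.mem_Iic.1 hx]
    simp only [NNReal.coe_one, mul_one] at h2
    rw [show -(t - m) ^ 2 / 2 = -(m - t) ^ 2 / 2 by ring]
    nlinarith

lemma integral_abs_empDist_sub_cdf_le {η : Measure ℝ} [IsProbabilityMeasure η]
    (hη : IsOneSubGaussian η) {n : ℕ} (hn : 0 < n) (t : ℝ) :
    Integrable (fun x : Fin n → ℝ => |empDist x t - cdf η t|) (Measure.pi fun _ => η) ∧
    ∫ x : Fin n → ℝ, |empDist x t - cdf η t| ∂(Measure.pi fun _ => η)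
      ≤ (√n)⁻¹ * Real.exp (-(1 / 4) * (t - ∫ y, y ∂η) ^ 2) := by
  have hn' : (0 : ℝ) < n := Nat.cast_pos.2 hn
  have hstep : MemLp (fun x => step x t) 2 η := by
    refine memLp_of_bounded (a := 0) (b := 1)
      (.of_forall fun x => ⟨step_nonneg _ _, step_le_one _ _⟩) (integrable_step_left η t).aestronglyMeasurable 2
  have hX := fun _ : Fin n => hstep.const_mul (n : ℝ)⁻¹
  have heval : ∀ k : Fin n, MemLp (fun x : Fin n → ℝ => (n : ℝ)⁻¹ * step (x k) t) 2
      (Measure.pi fun _ => η) := fun k =>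
    (hX k).comp_measurePreserving (measurePreserving_eval (fun _ => η) k)
  have hemp : MemLp (fun x : Fin n → ℝ => empDist x t) 2 (Measure.pi fun _ => η) :=
    memLp_finsetSum _ fun k _ => heval k
  have hZ := hemp.sub (memLp_const (μ := Measure.pi fun _ : Fin n => η) (p := 2) (cdf η t))
  have hmean : ∫ x : Fin n → ℝ, empDist x t ∂(Measure.pi fun _ => η) = cdf η t := by
    simp only [empDist]
    rw [integral_finsetSum _ fun k _ => (heval k).integrable (by norm_num)]
    have hk : ∀ k : Fin n, ∫ x : Fin n → ℝ, (n : ℝ)⁻¹ * step (x k) t ∂(Measure.pi fun _ => η)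
        = (n : ℝ)⁻¹ * cdf η t := fun k => by
      have := integral_comp_eval (μ := fun _ : Fin n => η) (i := k) (f := fun x => step x t)
        (integrable_step_left η t).aestronglyMeasurable
      rw [integral_const_mul, this, ← cdf_eq_integral_step]
    simp only [hk, Finset.sum_const, Finset.card_univ, Fintype.card_fin, nsmul_eq_mul]
    field_simp
  have hvar : ∫ x : Fin n → ℝ, (empDist x t - cdf η t) ^ 2 ∂(Measure.pi fun _ => η)
      ≤ (n : ℝ)⁻¹ * ((1 - cdf η t) * cdf η t) := by
    have h1 := variance_sum_pi (μ := fun _ : Fin n => η) hX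
    have h2 : (∑ k : Fin n, fun x : Fin n → ℝ => (n : ℝ)⁻¹ * step (x k) t)
        = fun x => empDist x t := by
      ext x
      simp [empDist]
    rw [h2, variance_eq_integral hemp.aestronglyMeasurable.aemeasurable, hmean] at h1
    rw [h1]
    have h3 := variance_le_sub_mul_sub (μ := η) (a := 0) (b := 1) (X := fun x => step x t)
      (.of_forall fun x => ⟨step_nonneg _ _, step_le_one _ _⟩)
      (integrable_step_left η t).aestronglyMeasurable.aemeasurable
    rw [← cdf_eq_integral_step, sub_zero] at h3
    simp only [variance_const_mul, Finset.sum_const, Finset.card_univ, Fintype.card_fin,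
      nsmul_eq_mul]
    calc (n : ℝ) * ((n : ℝ)⁻¹ ^ 2 * variance (fun x => step x t) η)
        = (n : ℝ)⁻¹ * variance (fun x => step x t) η := by field_simp
      _ ≤ _ := mul_le_mul_of_nonneg_left h3 (by positivity)
  refine ⟨(hZ.integrable (by norm_num)).abs, ?_⟩
  refine (sq_le_sq₀ (integral_nonneg fun _ => abs_nonneg _) (by positivity)).1 ?_
  refine (sq_integral_abs_le hZ).trans (hvar.trans ?_)
  refine (mul_le_mul_of_nonneg_left (hη.one_sub_cdf_mul_cdf_le t) (by positivity)).trans_eq ?_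
  rw [mul_pow, inv_pow, Real.sq_sqrt hn'.le, ← Real.exp_nat_mul]
  push_cast
  ring_nf

/-- The empirical distribution has expected Wasserstein distance `O (1 / √n)` from the law of the
sample; the integral of `exp (-t² / 4)` is `√(4π) ≤ 4`. -/
lemma integral_wass_empDist_le {S : Set ℝ} {η : Measure ℝ} (hη : FiniteMomentLaw S η)
    (hs : IsOneSubGaussian η) {n : ℕ} (hn : 0 < n) :
    ∫ x : Fin n → ℝ, wass (empDist x) (cdf η) ∂(Measure.pi fun _ => η) ≤ 4 / √n := by
  have := hη.prob
  have hn' : (0 : ℝ) < n := Nat.cast_pos.2 hn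
  have hG : Integrable fun t : ℝ => (√n)⁻¹ * Real.exp (-(1 / 4) * (t - ∫ y, y ∂η) ^ 2) :=
    ((integrable_exp_neg_mul_sq (by norm_num : (0 : ℝ) < 1 / 4)).comp_sub_right _).const_mul _
  have hGint : ∫ t : ℝ, (√n)⁻¹ * Real.exp (-(1 / 4) * (t - ∫ y, y ∂η) ^ 2) ≤ 4 / √n := by
    rw [integral_const_mul, integral_sub_right_eq_self (fun t => Real.exp (-(1 / 4) * t ^ 2)),
      integral_gaussian, div_eq_mul_inv, mul_comm]
    refine mul_le_mul_of_nonneg_right (Real.sqrt_le_iff.2 ⟨by norm_num, ?_⟩) (by positivity)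
    have := Real.pi_lt_four
    linarith
  refine le_trans ?_ hGint
  have hmeas : Measurable fun p : (Fin n → ℝ) × ℝ =>
      ENNReal.ofReal |empDist p.1 p.2 - cdf η p.2| := by
    have h1 : ∀ k, Measurable fun p : (Fin n → ℝ) × ℝ => step (p.1 k) p.2 := fun k =>
      measurable_step.comp (by fun_prop : Measurable fun p : (Fin n → ℝ) × ℝ => (p.1 k, p.2))
    have h2 : Measurable fun p : (Fin n → ℝ) × ℝ => empDist p.1 p.2 :=
      Finset.measurable_sum _ fun k _ => (h1 k).const_mul _
    have h3 : Measurable fun p : (Fin n → ℝ) × ℝ => cdf η p.2 :=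
      (monotone_cdf η).measurable.comp measurable_snd
    exact ENNReal.measurable_ofReal.comp ((h2.sub h3).abs)
  rw [← ENNReal.ofReal_le_ofReal_iff (integral_nonneg fun t => by positivity),
    ofReal_integral_eq_lintegral_ofReal ((coordLipschitz_wass_empDist hη hn).integrable hη.moment)
      (.of_forall fun _ => wass_nonneg _ _),
    ofReal_integral_eq_lintegral_ofReal hG (.of_forall fun t => by positivity)]
  calc ∫⁻ x, ENNReal.ofReal (wass (empDist x) (cdf η)) ∂(Measure.pi fun _ => η)
      = ∫⁻ x, (∫⁻ t, ENNReal.ofReal |empDist x t - cdf η t|) ∂(Measure.pi fun _ : Fin n => η) :=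
        lintegral_congr fun x => ofReal_integral_eq_lintegral_ofReal
          (integrable_empDist_sub_cdf hη hn x).abs (.of_forall fun _ => abs_nonneg _)
    _ = ∫⁻ t, (∫⁻ x, ENNReal.ofReal |empDist x t - cdf η t| ∂(Measure.pi fun _ : Fin n => η)) :=
        lintegral_lintegral_swap hmeas.aemeasurable
    _ ≤ _ := lintegral_mono fun t => by
        obtain ⟨h1, h2⟩ := integral_abs_empDist_sub_cdf_le hs hn t
        rw [← ofReal_integral_eq_lintegral_ofReal h1 (.of_forall fun _ => abs_nonneg _)]
        exact ENNReal.ofReal_le_ofReal h2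

/-- The deviation inequality behind the confidence widths. The tail is of order `T ^ (-128 e)`. -/
lemma measure_confidence_lt_wass_empDist_le {S : Set ℝ} {η : Measure ℝ} (hη : FiniteMomentLaw S η)
    (hs : IsOneSubGaussian η) {n : ℕ} (hn : 0 < n) {T : ℕ} (hT : 0 < T) :
    Measure.pi (fun _ : Fin n => η) {x | 16 * ((√(2 * Real.exp 1 * Real.log T) + 32) / √n)
        < wass (empDist x) (cdf η)} ≤ ENNReal.ofReal (((T : ℝ) ^ 3)⁻¹) := by
  have := hη.prob
  have hn' : (0 : ℝ) < n := Nat.cast_pos.2 hn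
  have hT' : (1 : ℝ) ≤ T := Nat.one_le_cast.2 hT
  have hlog : 0 ≤ Real.log T := Real.log_nonneg hT'
  have he : (2 : ℝ) ≤ Real.exp 1 := by linarith [Real.add_one_le_exp (1 : ℝ)]
  set s := 16 * √(2 * Real.exp 1 * Real.log T) / √n with hsdef
  have hsn : 0 < √(n : ℝ) := Real.sqrt_pos.2 hn'
  have hsub : {x : Fin n → ℝ | 16 * ((√(2 * Real.exp 1 * Real.log T) + 32) / √n)
        < wass (empDist x) (cdf η)}
      ⊆ {x | (∫ y : Fin n → ℝ, wass (empDist y) (cdf η) ∂(Measure.pi fun _ => η)) + s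
        ≤ wass (empDist x) (cdf η)} := by
    intro x hx
    have h1 := integral_wass_empDist_le hη hs hn
    have h2 : 16 * ((√(2 * Real.exp 1 * Real.log T) + 32) / √n) = s + 512 / √n := by
      rw [hsdef]; ring
    have h3 : 4 / √(n : ℝ) ≤ 512 / √n := by gcongr; norm_num
    simp only [Set.mem_ofPred_eq, h2] at hx ⊢
    linarith
  refine (measure_mono hsub).trans (((coordLipschitz_wass_empDist hη hn).measure_ge_le hs hη.moment
    hn (by positivity) (by positivity : 0 ≤ s)).trans (ENNReal.ofReal_le_ofReal ?_))
  have h4 : s ^ 2 / (4 * n * ((n : ℝ)⁻¹) ^ 2) = 128 * Real.exp 1 * Real.log T := by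
    rw [hsdef, div_pow, mul_pow, Real.sq_sqrt (by positivity), Real.sq_sqrt hn'.le]
    field_simp
    ring
  rw [h4, Real.exp_neg]
  refine inv_anti₀ (by positivity) ?_
  calc (T : ℝ) ^ 3 = Real.exp (3 * Real.log T) := by
        rw [← Real.exp_log (by linarith : (0 : ℝ) < T), ← Real.exp_nat_mul, Real.log_exp]
        norm_num
    _ ≤ _ := Real.exp_le_exp.2 (by nlinarith)

/-! ### Counting selections along a path -/

lemma pulls_succ {K : ℕ} (A : ℕ → Fin K) (t : ℕ) (i : Fin K) :
    pulls A (t + 1) i = pulls A t i + if A t = i then 1 else 0 := by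
  unfold pulls
  rw [Finset.range_add_one, Finset.filter_insert]
  split_ifs
  · rw [Finset.card_insert_of_notMem (by simp)]
  · rfl

lemma pulls_mono {K : ℕ} (A : ℕ → Fin K) (i : Fin K) : Monotone fun t => pulls A t i :=
  monotone_nat_of_le_succ fun t => by rw [pulls_succ]; exact Nat.le_add_right _ _

lemma pulls_le {K : ℕ} (A : ℕ → Fin K) (t : ℕ) (i : Fin K) : pulls A t i ≤ t :=
  (Finset.card_filter_le _ _).trans_eq (Finset.card_range t)

lemma sum_pulls {K : ℕ} (A : ℕ → Fin K) (t : ℕ) : ∑ i, pulls A t i = t := by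
  induction t with
  | zero => simp [pulls]
  | succ t ih => simp [pulls_succ, Finset.sum_add_distrib, ih]

lemma pulls_div_mem_stdSimplex {K : ℕ} (A : ℕ → Fin K) {T : ℕ} (hT : 0 < T) :
    (fun i => (pulls A T i : ℝ) / T) ∈ stdSimplex ℝ (Fin K) := by
  refine ⟨fun i => by positivity, ?_⟩
  have hT' : (T : ℝ) ≠ 0 := by positivity
  rw [← Finset.sum_div, ← Nat.cast_sum, sum_pulls, div_self hT']

/-- The empirical law of an arm after `t` rounds is that of its first `pulls A t i` rewards in the
reward table `y`. -/
lemma empCDF_eq_empDist {K : ℕ} (A : ℕ → Fin K) (y : Fin K → ℕ → ℝ) (t : ℕ) (i : Fin K) :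
    empCDF A (fun s => y (A s) (pulls A s (A s))) t i
      = empDist fun k : Fin (pulls A t i) => y i k := by
  ext x
  have h : (((Finset.range t).filter fun s => A s = i ∧ y (A s) (pulls A s (A s)) ≤ x).card : ℝ)
      = ∑ k ∈ Finset.range (pulls A t i), step (y i k) x := by
    induction t with
    | zero => rw [Finset.range_zero, Finset.filter_empty]; simp [pulls]
    | succ t ih =>
      rw [Finset.range_add_one, Finset.filter_insert, pulls_succ]
      by_cases hi : A t = i
      · subst hi
        rw [if_pos rfl, Finset.sum_range_succ, ← ih, step]
        by_cases hx : y (A t) (pulls A t (A t)) ≤ x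
        · simp [hx]
        · simp [hx]
      · simpa [hi] using ih
  rw [empCDF, h, empDist, Finset.sum_range, ← Finset.mul_sum, div_eq_inv_mul]

/-- Tracking a fixed target `b`: a selected arm is not yet over-sampled, since the deficits
`t * b j - pulls A t j` sum to zero, so no arm ever exceeds `T * b i + 1` selections. -/
lemma pulls_le_of_tracking {K : ℕ} {A : ℕ → Fin K} {b : Fin K → ℝ}
    (hb : b ∈ stdSimplex ℝ (Fin K)) {n T : ℕ} (hnT : n ≤ T)
    (hinit : ∀ i, (pulls A n i : ℝ) ≤ T * b i + 1)
    (htrack : ∀ t, n ≤ t → t < T →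
      ∀ j, (t : ℝ) * b j - pulls A t j ≤ (t : ℝ) * b (A t) - pulls A t (A t)) (i : Fin K) :
    (pulls A T i : ℝ) ≤ T * b i + 1 := by
  have key : ∀ t, n ≤ t → t ≤ T → (pulls A t i : ℝ) ≤ T * b i + 1 := by
    intro t hnt
    induction t, hnt using Nat.le_induction with
    | base => exact fun _ => hinit i
    | succ t hnt ih =>
      intro htT
      rw [pulls_succ]
      split_ifs with hi
      · have hmax := htrack t hnt htT
        rw [hi] at hmax
        have hsum : ∑ j, ((t : ℝ) * b j - pulls A t j) = 0 := by
          rw [Finset.sum_sub_distrib, ← Finset.mul_sum, hb.2, ← Nat.cast_sum, sum_pulls, mul_one,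
            sub_self]
        obtain ⟨j, -, hj⟩ := Finset.exists_le_of_sum_le (s := Finset.univ) ⟨i, Finset.mem_univ i⟩
          (f := fun _ => (0 : ℝ)) (g := fun j => (t : ℝ) * b j - pulls A t j) (by simp [hsum])
        have h1 := hmax j
        have h2 : (t : ℝ) * b i ≤ T * b i :=
          mul_le_mul_of_nonneg_right (Nat.cast_le.2 (Nat.le_of_succ_le htT)) (hb.1 i)
        push_cast
        linarith
      · simpa using ih (Nat.le_of_succ_le htT)
  exact key T hnT le_rfl

lemma sum_abs_sub_le_of_pulls_le {K : ℕ} {A : ℕ → Fin K} {b : Fin K → ℝ}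
    (hb : b ∈ stdSimplex ℝ (Fin K)) {T : ℕ} (hT : 0 < T)
    (h : ∀ i, (pulls A T i : ℝ) ≤ T * b i + 1) :
    ∑ i, |b i - (pulls A T i : ℝ) / T| ≤ 2 * K / T := by
  have hT' : (0 : ℝ) < T := Nat.cast_pos.2 hT
  have h1 : ∀ i, |b i - (pulls A T i : ℝ) / T| ≤ (b i - (pulls A T i : ℝ) / T) + 2 / T := by
    intro i
    have h2 : (pulls A T i : ℝ) / T ≤ b i + 1 / T := by
      rw [div_le_iff₀ hT', add_mul, one_div_mul_cancel hT'.ne']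
      linarith [h i]
    have h3 : (0 : ℝ) ≤ 1 / T := by positivity
    have h4 : (2 : ℝ) / T = 1 / T + 1 / T := by ring
    rw [abs_le]
    constructor <;> linarith
  refine (Finset.sum_le_sum fun i _ => h1 i).trans_eq ?_
  rw [Finset.sum_add_distrib, Finset.sum_sub_distrib, hb.2, (pulls_div_mem_stdSimplex A hT).2]
  simp
  ring

/-! ### The discretized simplex -/

lemma grid_subset_stdSimplex {K : ℕ} {ε : ℝ} (hε : 0 < ε) : grid K ε ⊆ stdSimplex ℝ (Fin K) :=
  fun _ ha => ⟨fun i => (half_pos hε).le.trans (ha.1 i), ha.2.1⟩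

lemma card_mul_le_of_mem_grid {K : ℕ} {ε : ℝ} {a : Fin K → ℝ} (ha : a ∈ grid K ε) :
    K * ε ≤ 2 := by
  have h := Finset.sum_le_sum fun (i : Fin K) (_ : i ∈ Finset.univ) => ha.1 i
  rw [ha.2.1] at h
  simp at h
  linarith

/-- Two different points of the grid differ in a coordinate other than the last one, where one of
them is at least `3 * ε / 2`. -/
lemma two_le_and_le_half_of_grid_nontrivial {K : ℕ} {ε : ℝ} (hε : 0 < ε)
    (h : (grid K ε).Nontrivial) : 2 ≤ K ∧ ε ≤ 1 / 2 := by
  obtain ⟨a, ha, b, hb, hab⟩ := h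
  have hex : ∃ i : Fin K, (i : ℕ) + 1 < K ∧ a i ≠ b i := by
    by_contra! hcon
    refine hab (funext fun i => ?_)
    by_cases hi : (i : ℕ) + 1 < K
    · exact hcon i hi
    · have hne : ∀ j ∈ Finset.univ.erase i, a j = b j := fun j hj => hcon j (by
        have := Finset.ne_of_mem_erase hj
        have := Fin.val_ne_of_ne this
        omega)
      have h1 := Finset.add_sum_erase Finset.univ a (Finset.mem_univ i)
      have h2 := Finset.add_sum_erase Finset.univ b (Finset.mem_univ i)
      rw [Finset.sum_congr rfl hne, ha.2.1] at h1
      rw [hb.2.1] at h2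
      linarith
  obtain ⟨i, hi, hne⟩ := hex
  refine ⟨by omega, ?_⟩
  have main : ∀ c ∈ grid K ε, ε * (3 / 2) ≤ c i → ε ≤ 1 / 2 := by
    intro c hc hci
    have hlast : ((⟨K - 1, by omega⟩ : Fin K)) ≠ i := fun h => by
      have := congrArg Fin.val h
      simp only at this
      omega
    have h1 := Finset.sum_le_sum_of_subset_of_nonneg
      (Finset.subset_univ {(⟨K - 1, by omega⟩ : Fin K), i})
      fun j _ _ => (grid_subset_stdSimplex hε hc).1 j
    rw [Finset.sum_pair hlast, hc.2.1] at h1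
    have h2 := hc.1 ⟨K - 1, by omega⟩
    linarith
  obtain ⟨n, hn⟩ := ha.2.2 i hi
  obtain ⟨m, hm⟩ := hb.2.2 i hi
  rcases Nat.eq_zero_or_pos n with rfl | hn0
  · rcases Nat.eq_zero_or_pos m with rfl | hm0
    · exact absurd (hn.trans hm.symm) hne
    · have : (1 : ℝ) ≤ m := Nat.one_le_cast.2 hm0
      exact main b hb (by rw [hm]; exact mul_le_mul_of_nonneg_left (by linarith) hε.le)
  · have : (1 : ℝ) ≤ n := Nat.one_le_cast.2 hn0
    exact main a ha (by rw [hn]; exact mul_le_mul_of_nonneg_left (by linarith) hε.le)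

/-- The weights of a grid point are less than `1`, because there is a second arm. -/
lemma lt_one_of_mem_grid {K : ℕ} {ε : ℝ} (hε : 0 < ε) (hK : 2 ≤ K) {a : Fin K → ℝ}
    (ha : a ∈ grid K ε) (i : Fin K) : a i < 1 := by
  have := Fin.nontrivial_iff_two_le.2 hK
  obtain ⟨j, hj⟩ := exists_ne i
  have h1 := Finset.sum_le_sum_of_subset_of_nonneg (Finset.subset_univ {j, i})
    fun k _ _ => (grid_subset_stdSimplex hε ha).1 k
  rw [Finset.sum_pair hj, ha.2.1] at h1
  linarith [ha.1 j]

/-! ### Optimistic indices -/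

lemma confWidth_nonneg {K : ℕ} (T : ℕ) (A : ℕ → Fin K) (t : ℕ) (i : Fin K) :
    0 ≤ confWidth T A t i := by
  unfold confWidth
  positivity

lemma rpow_sum_le_sum_rpow {ι : Type*} (s : Finset ι) {x : ι → ℝ} (hx : ∀ i, 0 ≤ x i) {q : ℝ}
    (hq : 0 < q) (hq_one : q ≤ 1) : (∑ i ∈ s, x i) ^ q ≤ ∑ i ∈ s, x i ^ q := by
  classical
  induction s using Finset.induction_on with
  | empty => simp [Real.zero_rpow hq.ne']
  | insert i s hi ih =>
    rw [Finset.sum_insert hi, Finset.sum_insert hi]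
    exact (Real.rpow_add_le_add_rpow (hx i) (Finset.sum_nonneg fun j _ => hx j) hq.le hq_one).trans
      (by gcongr)

/-- When the laws of the arms lie in the confidence sets, the optimistic index overestimates `V`, by
at most twice the bonus of CE-UCB-M. -/
lemma V_le_ucbIndex_and_ucbIndex_le {K : ℕ} {S : Set ℝ} {ν : Fin K → Measure ℝ} {h : ℝ → ℝ}
    {q L : ℝ} (hν : ∀ i, FiniteMomentLaw S (ν i)) (hq : 0 < q) (hq_one : q ≤ 1) (hL : 0 < L)
    (h_holder : IsHolderPM h S ν q L) (π : UCBPolicy) {T : ℕ} {A : ℕ → Fin K} {X : ℕ → ℝ} {t : ℕ}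
    (hlaw : ∀ i, ∃ G, FiniteMomentLaw S G ∧ (cdf G : ℝ → ℝ) = empCDF A X t i)
    (hgood : ∀ i, wass (empCDF A X t i) (cdf (ν i)) ≤ confWidth T A t i)
    {b : Fin K → ℝ} (hb : b ∈ stdSimplex ℝ (Fin K)) :
    V h ν b ≤ ucbIndex π h S q L T A X t b ∧
      ucbIndex π h S q L T A X t b ≤ V h ν b + 2 * L * ∑ i, (b i * confWidth T A t i) ^ q := by
  choose G hG hGX using hlaw
  have hnn : ∀ i, 0 ≤ b i * confWidth T A t i := fun i => mul_nonneg (hb.1 i) (confWidth_nonneg ..)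
  have hsum := rpow_sum_le_sum_rpow Finset.univ hnn hq hq_one
  set r := fun i => confWidth T A t i
  have hνG : ∀ i, wass (cdf (ν i)) (cdf (G i)) ≤ r i := fun i => by
    rw [hGX, wass_comm]
    exact hgood i
  -- a mixture of laws within Wasserstein distance `c * r i` of the arms
  have hclose : ∀ (c : ℝ) (η : Fin K → Measure ℝ), 0 ≤ c → (∀ i, FiniteMomentLaw S (η i)) →
      (∀ i, wass (cdf (ν i)) (cdf (η i)) ≤ c * r i) →
      |V h ν b - prefMetric h (mix b (armCDF η))| ≤ L * (c ^ q * ∑ i, (b i * r i) ^ q) := by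
    intro c η hc hη hw
    refine (abs_V_sub_prefMetric_mix_le h_holder hb hb hη).trans
      (mul_le_mul_of_nonneg_left ?_ hL.le)
    have h1 := wass_sum_le hb.1 fun i => integrable_cdf_sub_cdf (hν i) (hη i)
    have h2 : ∑ i, b i * wass (cdf (ν i)) (cdf (η i)) ≤ c * ∑ i, b i * r i := by
      rw [Finset.mul_sum]
      refine Finset.sum_le_sum fun i _ => ?_
      rw [mul_left_comm]
      exact mul_le_mul_of_nonneg_left (hw i) (hb.1 i)
    refine (Real.rpow_le_rpow (wass_nonneg _ _) (h1.trans h2) hq.le).trans ?_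
    rw [Real.mul_rpow hc (Finset.sum_nonneg fun i _ => hnn i)]
    exact mul_le_mul_of_nonneg_left hsum (by positivity)
  cases π with
  | U =>
    have hmem : V h ν b ∈ {u : ℝ | ∃ η : Fin K → Measure ℝ, (∀ i, η i ∈ confSet S T A X t i) ∧
        u = prefMetric h (mix b (armCDF η))} := ⟨ν, fun i => ⟨hν i, hgood i⟩, rfl⟩
    have hub : ∀ u ∈ {u : ℝ | ∃ η : Fin K → Measure ℝ, (∀ i, η i ∈ confSet S T A X t i) ∧
        u = prefMetric h (mix b (armCDF η))}, u ≤ V h ν b + 2 * L * ∑ i, (b i * r i) ^ q := by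
      rintro u ⟨η, hη, rfl⟩
      have h1 := hclose 2 η (by norm_num) (fun i => (hη i).1) fun i => by
        have h2 := wass_triangle (integrable_cdf_sub_cdf (hν i) (hG i))
          (integrable_cdf_sub_cdf (hG i) (hη i).1)
        have h3 := (hη i).2
        have h4 := hνG i
        rw [← hGX] at h3
        change wass (cdf (G i)) (cdf (η i)) ≤ r i at h3
        linarith
      have h5 : (2 : ℝ) ^ q ≤ 2 := by
        simpa using Real.rpow_le_rpow_of_exponent_le (by norm_num : (1 : ℝ) ≤ 2) hq_one
      have h6 : 0 ≤ ∑ i, (b i * r i) ^ q := Finset.sum_nonneg fun i _ => Real.rpow_nonneg (hnn i) _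
      have h7 : L * (2 ^ q * ∑ i, (b i * r i) ^ q) ≤ 2 * L * ∑ i, (b i * r i) ^ q := by
        have := mul_le_mul_of_nonneg_right h5 h6
        nlinarith
      linarith [(abs_le.1 h1).1]
    exact ⟨le_csSup ⟨_, hub⟩ hmem, csSup_le ⟨_, hmem⟩ hub⟩
  | C =>
    have h1 := hclose 1 G zero_le_one hG fun i => by rw [one_mul]; exact hνG i
    have h2 : armCDF G = empCDF A X t := funext hGX
    rw [h2, Real.one_rpow, one_mul] at h1
    obtain ⟨h3, h4⟩ := abs_le.1 h1
    simp only [ucbIndex]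
    constructor <;> linarith

/-- When all confidence widths are small compared with the gap `V h ν a₁ - V h ν a₂`, the best grid
point is the only maximizer of the optimistic index. -/
lemma eq_of_mem_optimistic {K : ℕ} {S : Set ℝ} {ν : Fin K → Measure ℝ} {h : ℝ → ℝ}
    {q L ε : ℝ} (hν : ∀ i, FiniteMomentLaw S (ν i)) (hq : 0 < q) (hq_one : q ≤ 1) (hL : 0 < L)
    (h_holder : IsHolderPM h S ν q L) (hε : 0 < ε) (hK : 2 ≤ K) {a₁ a₂ : Fin K → ℝ}
    (h_one : a₁ ∈ grid K ε) (h_two_max : IsMaxOn (V h ν) (grid K ε \ {a₁}) a₂)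
    (hgap : 0 < V h ν a₁ - V h ν a₂)
    (π : UCBPolicy) {T : ℕ} {A : ℕ → Fin K} {X : ℕ → ℝ} {t : ℕ}
    (hlaw : ∀ i, ∃ G, FiniteMomentLaw S G ∧ (cdf G : ℝ → ℝ) = empCDF A X t i)
    (hgood : ∀ i, wass (empCDF A X t i) (cdf (ν i)) ≤ confWidth T A t i)
    (hwidth : ∀ i, confWidth T A t i ≤ ((V h ν a₁ - V h ν a₂) / (2 * K * L)) ^ (1 / q))
    {b : Fin K → ℝ} (hb : b ∈ optimistic π h S q L ε T A X t) : b = a₁ := by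
  by_contra hne
  set δ := V h ν a₁ - V h ν a₂ with hδ
  have hK' : (0 : ℝ) < K := by positivity
  have hmono : V h ν b ≤ V h ν a₂ := h_two_max ⟨hb.1, hne⟩
  have h1 := (V_le_ucbIndex_and_ucbIndex_le hν hq hq_one hL h_holder π hlaw hgood
    (grid_subset_stdSimplex hε h_one)).1
  have h2 := (V_le_ucbIndex_and_ucbIndex_le hν hq hq_one hL h_holder π hlaw hgood
    (grid_subset_stdSimplex hε hb.1)).2
  have h3 := hb.2 a₁ h_one
  have hterm : ∀ i, (b i * confWidth T A t i) ^ q < δ / (2 * K * L) := by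
    intro i
    have hbi := (grid_subset_stdSimplex hε hb.1).1 i
    have hR : 0 < δ / (2 * K * L) := by positivity
    calc (b i * confWidth T A t i) ^ q ≤ (b i * (δ / (2 * K * L)) ^ (1 / q)) ^ q :=
          Real.rpow_le_rpow (mul_nonneg hbi (confWidth_nonneg ..))
            (mul_le_mul_of_nonneg_left (hwidth i) hbi) hq.le
      _ = b i ^ q * (δ / (2 * K * L)) := by
          rw [Real.mul_rpow hbi (by positivity), ← Real.rpow_mul hR.le, one_div_mul_cancel hq.ne',
            Real.rpow_one]
      _ < 1 * (δ / (2 * K * L)) := mul_lt_mul_of_pos_right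
          (Real.rpow_lt_one hbi (lt_one_of_mem_grid hε hK hb.1 i) hq) hR
      _ = _ := one_mul _
  have hne' : (Finset.univ : Finset (Fin K)).Nonempty := ⟨⟨0, by omega⟩, Finset.mem_univ _⟩
  have hlt := Finset.sum_lt_sum_of_nonempty hne' fun i _ => hterm i
  have h4 : 2 * L * ∑ i, (b i * confWidth T A t i) ^ q < δ := by
    refine (mul_lt_mul_of_pos_left hlt (by positivity)).trans_eq ?_
    simp only [Finset.sum_const, Finset.card_univ, Fintype.card_fin, nsmul_eq_mul]
    field_simp
  linarith

/-! ### The time threshold and the exploration phase -/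

/-- Beyond the threshold the time `⌈T / 4⌉` is good, because `2 / ε ≥ 4`. -/
lemma ceil_mem_goodTimes {K : ℕ} {ε ρ q L δ : ℝ} (hε : 0 < ε) (hε' : ε ≤ 1 / 2) {T : ℕ}
    (hT : Tthr K ε ρ q L δ < T) : ⌈(T : ℝ) / 4⌉₊ ∈ goodTimes K ε ρ q L δ := by
  set s := ⌈(T : ℝ) / 4⌉₊
  by_contra hs
  have hT0 : ((s + 1 : ℕ) : ENNReal) ≤ T0 K ε ρ q L δ := by
    refine le_iInf₂ fun t ht => Nat.cast_le.2 ?_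
    by_contra! hlt
    have hts : t ≤ s := by omega
    exact hs ⟨ht.1.trans hts, fun u hu => ht.2 u (hts.trans hu)⟩
  refine absurd hT (not_lt.2 ?_)
  have h1 : (s : ENNReal) ≤ T0 K ε ρ q L δ - 1 := by
    refine ENNReal.le_sub_of_add_le_right ENNReal.one_ne_top ?_
    simpa using hT0
  have h4 : (4 : ENNReal) ≤ ENNReal.ofReal (2 / ε) := by
    rw [show (4 : ENNReal) = ENNReal.ofReal 4 by simp]
    refine ENNReal.ofReal_le_ofReal ?_
    rw [le_div_iff₀ hε]
    linarith
  have h2 : T ≤ 4 * s := by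
    have := Nat.le_ceil ((T : ℝ) / 4)
    have h : (T : ℝ) ≤ 4 * s := by linarith
    exact_mod_cast h
  calc (T : ENNReal) ≤ ((4 * s : ℕ) : ENNReal) := Nat.cast_le.2 h2
    _ = 4 * (s : ENNReal) := by push_cast; rfl
    _ ≤ _ := mul_le_mul' h4 h1

lemma gap_pos_of_mem_goodTimes {K : ℕ} {ε ρ q L δ : ℝ} (hε : 0 < ε) (hρ : 0 < ρ) (hq : 0 < q)
    (hδ : 0 ≤ δ) {t : ℕ} (ht : t ∈ goodTimes K ε ρ q L δ) : 0 < δ := by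
  refine lt_of_le_of_ne hδ fun h0 => ?_
  have h1 := ht.2 t le_rfl
  rw [← h0, zero_div, Real.zero_rpow (one_div_pos.2 hq).ne', mul_zero] at h1
  have h2 : (0 : ℝ) < t := Nat.cast_pos.2 ht.1
  have h3 : 0 < (2 * √(2 * Real.exp 1 * Real.log t) + 32) / √(ρ * t * ε) := by positivity
  linarith

/-- The condition on the threshold, taken at time `⌈T / 4⌉`, controls the confidence widths at
horizon `T` after the exploration phase. -/
lemma width_le_of_mem_goodTimes {K : ℕ} {ε ρ q L δ : ℝ} (hε : 0 < ε) (hρ : 0 < ρ) {T : ℕ}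
    (hT : 1000 ≤ T) (ht : ⌈(T : ℝ) / 4⌉₊ ∈ goodTimes K ε ρ q L δ) :
    32 * (√(2 * Real.exp 1 * Real.log T) + 32) / √(ρ * T * ε)
      ≤ (δ / (2 * K * L)) ^ (1 / q) := by
  have h1 := ht.2 _ le_rfl
  set s := ⌈(T : ℝ) / 4⌉₊
  have hTr : (1000 : ℝ) ≤ T := by exact_mod_cast hT
  have hs1 : (T : ℝ) / 4 ≤ s := Nat.le_ceil _
  have hs2 : (s : ℝ) < T / 4 + 1 := Nat.ceil_lt_add_one (by positivity)
  have he : (2 : ℝ) ≤ Real.exp 1 := by linarith [Real.add_one_le_exp (1 : ℝ)]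
  set M := √(2 * Real.exp 1 * Real.log T)
  set m := √(2 * Real.exp 1 * Real.log s)
  have hlogT : 1 ≤ Real.log T := by
    rw [Real.le_log_iff_exp_le (by linarith)]
    linarith [Real.exp_one_lt_d9]
  have hlogs : Real.log T ≤ 2 * Real.log s := by
    rw [← Real.log_rpow (by linarith)]
    refine Real.log_le_log (by linarith) ?_
    rw [Real.rpow_two]
    nlinarith
  have hM1 : 1 ≤ M := Real.one_le_sqrt.2 (by nlinarith)
  -- `M² ≤ 2 m²`, and `√2 ≤ 10 / 7`
  have hMm : M ≤ 10 / 7 * m := by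
    refine Real.sqrt_le_iff.2 ⟨by positivity, ?_⟩
    rw [mul_pow, Real.sq_sqrt (by nlinarith)]
    nlinarith
  have hsq : √(s : ℝ) ≤ √T * (1 / 2 + 1 / T) := by
    refine Real.sqrt_le_iff.2 ⟨by positivity, ?_⟩
    rw [mul_pow, Real.sq_sqrt (by linarith)]
    have : (T : ℝ) * (1 / 2 + 1 / T) ^ 2 = T / 4 + 1 + 1 / T := by field_simp; ring
    rw [this]
    have : (0 : ℝ) ≤ 1 / T := by positivity
    linarith
  have hT1 : 1 / (T : ℝ) ≤ 1 / 1000 := one_div_le_one_div_of_le (by norm_num) hTr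
  have hspos : (0 : ℝ) < s := by linarith
  have key : 2 * (M + 32) * √s ≤ (2 * m + 32) * √T := by
    calc 2 * (M + 32) * √s ≤ 2 * (M + 32) * (√T * (1 / 2 + 1 / T)) := by gcongr
      _ = ((M + 32) * (1 + 2 * (1 / T))) * √T := by ring
      _ ≤ (2 * m + 32) * √T := by
          gcongr
          nlinarith
  have hsplit : ∀ x : ℝ, 0 < x → √(ρ * x * ε) = √(ρ * ε) * √x := fun x _ => by
    rw [← Real.sqrt_mul (by positivity)]; ring_nf
  rw [hsplit s hspos] at h1
  rw [hsplit T (by linarith)]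
  have hre : 0 < √(ρ * ε) := Real.sqrt_pos.2 (by positivity)
  have hss : 0 < √(s : ℝ) := Real.sqrt_pos.2 hspos
  have hTT : 0 < √(T : ℝ) := Real.sqrt_pos.2 (by linarith)
  have h2 : 32 * (M + 32) / (√(ρ * ε) * √T) ≤ 16 * ((2 * m + 32) / (√(ρ * ε) * √s)) := by
    rw [← mul_div_assoc, div_le_div_iff₀ (by positivity) (by positivity)]
    nlinarith [mul_le_mul_of_nonneg_left key hre.le]
  linarith

lemma two_mul_le_exp (x : ℝ) (hx : 0 ≤ x) : 2 * x ≤ Real.exp x := by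
  nlinarith [Real.quadratic_le_exp_of_nonneg hx, sq_nonneg (x - 1)]

lemma mul_explore_le {K T : ℕ} {ε ρ : ℝ} (hε : 0 < ε) (hρ : 0 < ρ) (hρ_one : ρ < 1)
    (hKε : K * ε ≤ 2) (hT : Real.exp K < T) : K * explore ε ρ T ≤ T := by
  have hK := two_mul_le_exp K (by positivity)
  have h1 : (explore ε ρ T : ℝ) < ρ * T * ε / 4 + 1 := Nat.ceil_lt_add_one (by positivity)
  have h2 : (K : ℝ) * explore ε ρ T ≤ T := by
    have h3 := mul_le_mul_of_nonneg_left h1.le (Nat.cast_nonneg (α := ℝ) K)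
    have h4 : ρ * T * (K * ε) ≤ 1 * T * 2 := by gcongr
    nlinarith
  exact_mod_cast h2

/-! ### Runs on the event that all empirical laws are accurate -/

/-- If the empirical laws of all arms are within the confidence widths of the true ones throughout,
then the estimate is the best grid point from the end of the exploration on, and tracking makes the
final proportions of the selections approach it. -/
lemma sum_abs_sub_le_of_accurate {K : ℕ} {S : Set ℝ} {ν : Fin K → Measure ℝ} {h : ℝ → ℝ}
    {q L ε ρ : ℝ} {T : ℕ} (hν : ∀ i, FiniteMomentLaw S (ν i)) (hq : 0 < q) (hq_one : q ≤ 1)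
    (hL : 0 < L) (h_holder : IsHolderPM h S ν q L) (hρ : 0 < ρ) (hρ_one : ρ < 1) (hε : 0 < ε)
    (hK : 2 ≤ K) {a₁ a₂ : Fin K → ℝ} (h_one : a₁ ∈ grid K ε)
    (h_two_max : IsMaxOn (V h ν) (grid K ε \ {a₁}) a₂) (hgap : 0 < V h ν a₁ - V h ν a₂)
    (hT : Real.exp K < T)
    (hwidth : 32 * (√(2 * Real.exp 1 * Real.log T) + 32) / √(ρ * T * ε)
      ≤ ((V h ν a₁ - V h ν a₂) / (2 * K * L)) ^ (1 / q))
    (π : UCBPolicy) {A : ℕ → Fin K} {y : Fin K → ℕ → ℝ} {a : ℕ → Fin K → ℝ}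
    (hyS : ∀ i n, y i n ∈ S)
    (hgood : ∀ i n, 1 ≤ n → n ≤ T → wass (empDist fun k : Fin n => y i k) (cdf (ν i))
      ≤ 16 * ((√(2 * Real.exp 1 * Real.log T) + 32) / √n))
    (hrun : IsRun π h S q L ε ρ T A (fun s => y (A s) (pulls A s (A s))) a) :
    ∑ i, |a₁ i - (pulls A T i : ℝ) / T| ≤ 2 * K / T := by
  have hTpos : (0 : ℝ) < T := (Real.exp_pos _).trans hT
  have hKN := mul_explore_le hε hρ hρ_one (card_mul_le_of_mem_grid h_one) hT
  have hexp : ρ * T * ε / 4 ≤ explore ε ρ T := Nat.le_ceil _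
  have ha₁ := grid_subset_stdSimplex hε h_one
  have hest : ∀ t, K * explore ε ρ T ≤ t → t ≤ T → a t = a₁ := by
    intro t ht htT
    have hpull : ∀ i, (explore ε ρ T : ℝ) ≤ pulls A t i := fun i => by
      rw [← hrun.exploration i]
      exact_mod_cast pulls_mono A i ht
    have hpos : ∀ i, 0 < pulls A t i := fun i => by
      have : (0 : ℝ) < pulls A t i :=
        (by positivity : 0 < ρ * T * ε / 4).trans_le (hexp.trans (hpull i))
      exact_mod_cast this
    refine eq_of_mem_optimistic hν hq hq_one hL h_holder hε hK h_one h_two_max hgap π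
      (fun i => ?_) (fun i => ?_) (fun i => le_trans ?_ hwidth) (hrun.estimate t ht htT)
    · rw [empCDF_eq_empDist]
      exact exists_law_of_empDist (hpos i) fun k => hyS i k
    · rw [empCDF_eq_empDist]
      exact hgood i _ (hpos i) ((pulls_le A t i).trans htT)
    · have h1 : √(ρ * T * ε) / 2 ≤ √(pulls A t i : ℝ) := by
        refine Real.le_sqrt_of_sq_le ?_
        rw [div_pow, Real.sq_sqrt (by positivity)]
        linarith [hpull i]
      have h2 : 0 < √(ρ * T * ε) := Real.sqrt_pos.2 (by positivity)
      calc confWidth T A t i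
          ≤ 16 * ((√(2 * Real.exp 1 * Real.log T) + 32) / (√(ρ * T * ε) / 2)) := by
            unfold confWidth
            gcongr
        _ = _ := by field_simp; ring
  refine sum_abs_sub_le_of_pulls_le ha₁ (Nat.cast_pos.1 hTpos)
    (pulls_le_of_tracking ha₁ hKN (fun i => ?_) fun t ht htT j => ?_)
  · rw [hrun.exploration i]
    have h1 : (explore ε ρ T : ℝ) < ρ * T * ε / 4 + 1 := Nat.ceil_lt_add_one (by positivity)
    have h2 : ρ * (T * ε) ≤ 1 * (T * ε) := by gcongr
    have h3 : T * (ε / 2) ≤ T * a₁ i := mul_le_mul_of_nonneg_left (h_one.1 i) hTpos.le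
    have h4 : 0 < T * ε := by positivity
    nlinarith
  · have := hrun.tracking t ht htT j
    rwa [hest t ht htT.le] at this

/-! ### The reward table -/

section Probability

variable {K : ℕ} {S : Set ℝ} {ν : Fin K → Measure ℝ} {Ω : Type*} [MeasurableSpace Ω]
  {P : Measure Ω} {Y : Fin K → ℕ → Ω → ℝ}

lemma IsRewardTable.ae_mem (hY : IsRewardTable P ν Y) (hν : ∀ i, FiniteMomentLaw S (ν i)) :
    ∀ᵐ ω ∂P, ∀ i n, Y i n ω ∈ S := by
  refine ae_all_iff.2 fun i => ae_all_iff.2 fun n => ?_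
  have := (hν i).support
  rw [← hY.law i n] at this
  exact ae_of_ae_map (hY.measurable i n).aemeasurable this

lemma IsRewardTable.map_eq_pi (hY : IsRewardTable P ν Y) (i : Fin K) (n : ℕ) :
    P.map (fun ω (k : Fin n) => Y i k ω) = Measure.pi fun _ => ν i := by
  have hinj : Function.Injective fun k : Fin n => (i, (k : ℕ)) := fun k l hkl =>
    Fin.ext (congrArg Prod.snd hkl)
  have h := iIndepFun.map_fun_eq_pi_map (f := fun k : Fin n => Y i k)
    (fun k => (hY.measurable i k).aemeasurable) (hY.indep.precomp hinj)
  simpa only [hY.law] using h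

variable [IsProbabilityMeasure P]

/-- With high probability all empirical laws based on at most `T` samples are accurate. -/
lemma IsRewardTable.exists_accurate (hY : IsRewardTable P ν Y)
    (hν : ∀ i, FiniteMomentLaw S (ν i)) (hs : ∀ i, IsOneSubGaussian (ν i)) {T : ℕ} (hT : 0 < T)
    (hKT : K ≤ T) :
    ∃ E : Set Ω, MeasurableSet E ∧ P.real E ≤ 1 / T ∧ ∀ ω ∉ E, ∀ i n, 1 ≤ n → n ≤ T →
      wass (empDist fun k : Fin n => Y i k ω) (cdf (ν i))
        ≤ 16 * ((√(2 * Real.exp 1 * Real.log T) + 32) / √n) := by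
  have hT' : (0 : ℝ) < T := Nat.cast_pos.2 hT
  set B : Fin K → (n : ℕ) → Set (Fin n → ℝ) := fun i n =>
    {x | 16 * ((√(2 * Real.exp 1 * Real.log T) + 32) / √n) < wass (empDist x) (cdf (ν i))}
  set E : Fin K → ℕ → Set Ω := fun i n => (fun ω (k : Fin n) => Y i k ω) ⁻¹' B i n
  have hmeas : ∀ i n, Measurable fun ω (k : Fin n) => Y i k ω := fun i n =>
    measurable_pi_lambda _ fun k => hY.measurable i k
  have hB : ∀ i n, 0 < n → MeasurableSet (B i n) := fun i n hn =>
    measurableSet_lt measurable_const (coordLipschitz_wass_empDist (hν i) hn).continuous.measurable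
  have hPE : ∀ i n, 0 < n → P.real (E i n) ≤ ((T : ℝ) ^ 3)⁻¹ := by
    intro i n hn
    refine ENNReal.toReal_le_of_le_ofReal (by positivity) ?_
    rw [← Measure.map_apply (hmeas i n) (hB i n hn), hY.map_eq_pi]
    exact measure_confidence_lt_wass_empDist_le (hν i) (hs i) hn hT
  refine ⟨⋃ i, ⋃ n ∈ Finset.Icc 1 T, E i n, ?_, ?_, ?_⟩
  · exact MeasurableSet.iUnion fun i => Finset.measurableSet_biUnion _ fun n hn =>
      hmeas i n (hB i n (Finset.mem_Icc.1 hn).1)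
  · calc P.real (⋃ i, ⋃ n ∈ Finset.Icc 1 T, E i n)
        ≤ ∑ i, P.real (⋃ n ∈ Finset.Icc 1 T, E i n) := measureReal_iUnion_fintype_le _
      _ ≤ ∑ i : Fin K, ∑ n ∈ Finset.Icc 1 T, P.real (E i n) :=
          Finset.sum_le_sum fun i _ => measureReal_biUnion_finset_le _ _
      _ ≤ ∑ i : Fin K, ∑ n ∈ Finset.Icc 1 T, ((T : ℝ) ^ 3)⁻¹ :=
          Finset.sum_le_sum fun i _ => Finset.sum_le_sum fun n hn =>
            hPE i n (Finset.mem_Icc.1 hn).1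
      _ = K * (T * ((T : ℝ) ^ 3)⁻¹) := by simp
      _ ≤ T * (T * ((T : ℝ) ^ 3)⁻¹) := by gcongr
      _ = 1 / T := by field_simp
  · intro ω hω i n h1 hn
    by_contra! hlt
    exact hω (Set.mem_iUnion.2 ⟨i, Set.mem_iUnion₂.2 ⟨n, Finset.mem_Icc.2 ⟨h1, hn⟩, hlt⟩⟩)

lemma measurable_pulls {A : ℕ → Ω → Fin K} (hA : ∀ s, Measurable (A s)) (t : ℕ) (i : Fin K) :
    Measurable fun ω => pulls (fun s => A s ω) t i := by
  induction t with
  | zero => simp [pulls]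
  | succ t ih =>
    simp only [pulls_succ]
    exact ih.add (Measurable.ite (hA t (measurableSet_singleton i)) measurable_const
      measurable_const)

/-- The regret is bounded through a bound `D₁` on the loss of every path, and a better bound `D₀`
that holds almost surely outside of an event `E`. -/
lemma regret_le_of_ae {h : ℝ → ℝ} {A : ℕ → Ω → Fin K} (hA : ∀ s, Measurable (A s)) {T : ℕ}
    {αstar : Fin K → ℝ} {v D₀ D₁ : ℝ} (hD₀ : 0 ≤ D₀)
    (hD₁ : ∀ ω, |v - V h ν (fun i => (pulls (fun r => A r ω) T i : ℝ) / T)| ≤ D₁)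
    {E : Set Ω} (hE : MeasurableSet E)
    (hD : ∀ᵐ ω ∂P, ω ∉ E → |v - V h ν (fun i => (pulls (fun r => A r ω) T i : ℝ) / T)| ≤ D₀) :
    regret P h ν αstar A T ≤ D₀ + P.real E * D₁ + (V h ν αstar - v) := by
  set f : Ω → ℝ := fun ω => V h ν fun i => (pulls (fun r => A r ω) T i : ℝ) / T
  have hf : Measurable f :=
    (measurable_of_countable fun p : Fin K → ℕ => V h ν fun i => (p i : ℝ) / T).comp
      (measurable_pi_lambda _ fun i => measurable_pulls hA T i)
  have hint : Integrable (fun ω => v - f ω) P :=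
    .of_bound (measurable_const.sub hf).aestronglyMeasurable D₁ (.of_forall hD₁)
  have hfint : Integrable f P := ((integrable_const v).sub hint).congr (.of_forall fun ω => by simp)
  have hbound : ∫ ω, (v - f ω) ∂P ≤ ∫ ω, (D₀ + E.indicator (fun _ => D₁) ω) ∂P := by
    refine integral_mono_ae hint
      ((integrable_const _).add ((integrable_const D₁).indicator hE)) ?_
    filter_upwards [hD] with ω hω
    by_cases hωE : ω ∈ E
    · simp only [Set.indicator_of_mem hωE]
      linarith [le_of_abs_le (hD₁ ω)]
    · simp only [Set.indicator_of_notMem hωE, add_zero]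
      exact le_of_abs_le (hω hωE)
  rw [integral_sub (integrable_const v) hfint, integral_add (integrable_const _)
    ((integrable_const D₁).indicator hE), integral_indicator_const _ hE] at hbound
  simp only [integral_const, probReal_univ, smul_eq_mul] at hbound
  unfold regret
  linarith

end Probability

end

end PMBandit

open MeasureTheory PMBandit in
theorem theorem8
    {K : ℕ} {S : Set ℝ} {ν : Fin K → Measure ℝ} {h : ℝ → ℝ} {q L ε ρ : ℝ} {T : ℕ}
    -- the distortion function and the arms
    (h_zero : h 0 = 0) (h_range : ∀ u ∈ Set.Icc (0 : ℝ) 1, h u ∈ Set.Icc (0 : ℝ) 1)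
    (h_arms : ∀ i, FiniteMomentLaw S (ν i)) (h_sub : ∀ i, IsOneSubGaussian (ν i))
    (hq : 0 < q) (hq_one : q ≤ 1) (hL : 0 < L) (h_holder : IsHolderPM h S ν q L)
    -- the exploration rate, and a discretization level for which a second best mixture exists
    (hρ : 0 < ρ) (hρ_one : ρ < 1) (hε : 0 < ε) (h_grid : (grid K ε).Nontrivial)
    -- the optimal mixture and the best and second best discrete mixtures
    {αstar a₁ a₂ : Fin K → ℝ}
    (h_star : αstar ∈ stdSimplex ℝ (Fin K)) (h_star_max : IsMaxOn (V h ν) (stdSimplex ℝ (Fin K)) αstar)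
    (h_one : a₁ ∈ grid K ε) (h_one_max : IsMaxOn (V h ν) (grid K ε) a₁)
    (h_two : a₂ ∈ grid K ε \ {a₁}) (h_two_max : IsMaxOn (V h ν) (grid K ε \ {a₁}) a₂)
    -- the horizon
    (hT : max (ENNReal.ofReal (Real.exp K)) (Tthr K ε ρ q L (V h ν a₁ - V h ν a₂)) < (T : ENNReal))
    -- a run of either policy against i.i.d. rewards
    (π : UCBPolicy)
    {Ω : Type*} [MeasurableSpace Ω] {P : Measure Ω} [IsProbabilityMeasure P]
    {Y : Fin K → ℕ → Ω → ℝ} (hY : IsRewardTable P ν Y)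
    {A : ℕ → Ω → Fin K} (hA : ∀ s, Measurable (A s)) {a : ℕ → Ω → Fin K → ℝ}
    (h_run : ∀ᵐ ω ∂P, IsRun π h S q L ε ρ T (fun s => A s ω) (reward Y A ω) (fun t => a t ω)) :
    regret P h ν αstar A T ≤
      (maxPM h ν + 2 * L * K * (wassRatio ν ^ q + 1)) *
          (64 * (√(2 * Real.exp 1 * Real.log T) + 32) / √(ε * ρ * T)) ^ q
        + (V h ν αstar - V h ν a₁) := by
  obtain ⟨hT_exp, hT_thr⟩ := max_lt_iff.1 hT
  replace hT_exp : Real.exp K < T := by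
    rw [← ENNReal.ofReal_natCast] at hT_exp
    exact (ENNReal.ofReal_lt_ofReal_iff_of_nonneg (Real.exp_pos _).le).1 hT_exp
  obtain ⟨hK, hε_half⟩ := two_le_and_le_half_of_grid_nontrivial hε h_grid
  have hKr : (2 : ℝ) ≤ K := by exact_mod_cast hK
  have hTr : (0 : ℝ) < T := (Real.exp_pos _).trans hT_exp
  have hTpos : 0 < T := Nat.cast_pos.1 hTr
  have hKT : (2 : ℝ) * K ≤ T := (two_mul_le_exp K (by positivity)).trans hT_exp.le
  have ha₁ := grid_subset_stdSimplex hε h_one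
  set c := √(2 * Real.exp 1 * Real.log T) + 32 with hc
  set B := 64 * c / √(ε * ρ * T) with hB
  set W := wassRatio ν
  have hW : 0 ≤ W := wassRatio_nonneg ν
  have hWq : 0 ≤ W ^ q := Real.rpow_nonneg hW q
  have hc32 : 32 ≤ c := by rw [hc]; linarith [Real.sqrt_nonneg (2 * Real.exp 1 * Real.log T)]
  have hsqrt : 0 < √(ε * ρ * T) := Real.sqrt_pos.2 (by positivity)
  have hB0 : 0 < B := by positivity
  have hmax : 0 ≤ maxPM h ν := Real.sSup_nonneg (by rintro b ⟨α, -, rfl⟩; exact abs_nonneg _)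
  -- all mixtures are within `ℓ₁` distance `2` of `a₁`
  have hloss : ∀ ω, |V h ν a₁ - V h ν (fun i => (pulls (fun r => A r ω) T i : ℝ) / T)|
      ≤ 2 * L * W ^ q := by
    intro ω
    have hβ := pulls_div_mem_stdSimplex (fun r => A r ω) hTpos
    refine (abs_V_sub_V_le hq hL h_holder h_arms ha₁ hβ).trans ?_
    have h1 : ∑ i, |a₁ i - (pulls (fun r => A r ω) T i : ℝ) / T| ≤ 2 := by
      calc ∑ i, |a₁ i - (pulls (fun r => A r ω) T i : ℝ) / T|
          ≤ ∑ i, (a₁ i + (pulls (fun r => A r ω) T i : ℝ) / T) := Finset.sum_le_sum fun i _ => by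
            rw [abs_le]
            constructor <;> linarith [ha₁.1 i, hβ.1 i]
        _ = 2 := by rw [Finset.sum_add_distrib, ha₁.2, hβ.2]; norm_num
    have h2 : (2 : ℝ) ^ q ≤ 2 := by
      simpa using Real.rpow_le_rpow_of_exponent_le (by norm_num : (1 : ℝ) ≤ 2) hq_one
    calc L * (W * ∑ i, |a₁ i - (pulls (fun r => A r ω) T i : ℝ) / T|) ^ q
        ≤ L * (W * 2) ^ q := by gcongr
      _ = L * (W ^ q * 2 ^ q) := by rw [Real.mul_rpow hW (by norm_num)]
      _ ≤ L * (W ^ q * 2) := by gcongr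
      _ = _ := by ring
  -- of the claimed constant only the part `4 * L * W ^ q` is needed, as `2 ≤ K`
  have hfinal : 4 * L * W ^ q * B ^ q ≤ (maxPM h ν + 2 * L * K * (W ^ q + 1)) * B ^ q := by
    refine mul_le_mul_of_nonneg_right ?_ (by positivity)
    have h1 : 0 ≤ L * W ^ q := by positivity
    have h2 : 0 ≤ L * K := by positivity
    nlinarith
  have hLW : 0 ≤ L * W ^ q := by positivity
  rcases le_or_gt 1 B with hB1 | hB1
  · have hBq : 1 ≤ B ^ q := Real.one_le_rpow hB1 hq.le
    have h1 := regret_le_of_ae (P := P) (αstar := αstar) hA (by positivity) hloss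
      MeasurableSet.empty (.of_forall fun ω _ => hloss ω)
    rw [measureReal_empty, zero_mul, add_zero] at h1
    nlinarith
  · have hTbig : 1000 ≤ T := by
      have h1 : 64 * 32 < √(ε * ρ * T) := by
        rw [hB, div_lt_one hsqrt] at hB1
        linarith
      have h2 := Real.lt_sqrt (by norm_num) |>.1 h1
      have h3 : ε * ρ ≤ 1 * 1 := by gcongr; linarith
      have h4 : (1000 : ℝ) ≤ T := by nlinarith
      exact_mod_cast h4
    have hceil := ceil_mem_goodTimes hε hε_half hT_thr
    have hgap := gap_pos_of_mem_goodTimes hε hρ hq (sub_nonneg.2 (h_one_max h_two.1)) hceil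
    obtain ⟨E, hE, hPE, hacc⟩ := hY.exists_accurate h_arms h_sub hTpos (by
      have : (K : ℝ) ≤ T := by linarith
      exact_mod_cast this)
    have hrT : √(ε * ρ * T) ≤ √T := Real.sqrt_le_sqrt (by
      have h3 : ε * ρ ≤ 1 * 1 := by gcongr; linarith
      nlinarith)
    have hsT : √(T : ℝ) * √T = T := Real.mul_self_sqrt hTr.le
    have hsT0 : 0 < √(T : ℝ) := Real.sqrt_pos.2 hTr
    -- `K² / 2 ≤ exp K < T`, so that `2 * K / T` is at most `4 / √T`
    have hKB : 2 * K / T ≤ B := by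
      have hKsq : (K : ℝ) / 2 ≤ √T := by
        refine Real.le_sqrt_of_sq_le ?_
        nlinarith [Real.quadratic_le_exp_of_nonneg (Nat.cast_nonneg (α := ℝ) K)]
      calc 2 * K / T ≤ 64 * c / √T := by
            rw [div_le_div_iff₀ hTr hsT0]
            nlinarith
        _ ≤ B := by rw [hB]; gcongr
    have hPB : P.real E ≤ B ^ q := by
      have h1 : 1 / (T : ℝ) ≤ 2 * K / T := by gcongr; linarith
      refine (hPE.trans (h1.trans hKB)).trans ?_
      simpa using Real.rpow_le_rpow_of_exponent_ge hB0 hB1.le hq_one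
    have hgood : ∀ᵐ ω ∂P, ω ∉ E →
        |V h ν a₁ - V h ν (fun i => (pulls (fun r => A r ω) T i : ℝ) / T)| ≤ L * W ^ q * B ^ q := by
      filter_upwards [h_run, hY.ae_mem h_arms] with ω hrun hS hω
      have h1 := sum_abs_sub_le_of_accurate h_arms hq hq_one hL h_holder hρ hρ_one hε hK h_one
        h_two_max hgap hT_exp (width_le_of_mem_goodTimes hε hρ hTbig hceil) π hS (hacc ω hω) hrun
      refine (abs_V_sub_V_le hq hL h_holder h_arms ha₁
        (pulls_div_mem_stdSimplex (fun r => A r ω) hTpos)).trans ?_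
      rw [mul_assoc, ← Real.mul_rpow hW hB0.le]
      have h2 := h1.trans hKB
      gcongr
    have h1 := regret_le_of_ae (αstar := αstar) hA (by positivity) hloss hE hgood
    have h2 := mul_le_mul_of_nonneg_right hPB (by positivity : 0 ≤ 2 * L * W ^ q)
    have h3 : 0 ≤ L * W ^ q * B ^ q := by positivity
    linarith
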